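/- Let $\mathcal G=(\mathrm{SO}(2)\ltimes\mathbb R^3)\times\mathrm{SO}(2)$, with multiplication $(\phi_1,a_1,\theta_1)(\phi_2,a_2,\theta_2)=(\phi_1+\phi_2,\;a_1+R_{\phi_1}a_2,\;\theta_1+\theta_2)$, where $R_\phi$ is the rotation of $\mathbb R^3$ by $\phi$ about the third axis. Put $\mathcal K=\{(0,a,\theta)\}\cong\mathbb R^3\times\mathrm{SO}(2)$. Let $(\mathcal M,\omega)$ be a connected (finite-dimensional, smooth, Hausdorff, second countable) symplectic manifold on which $\mathcal G$ acts smoothly, properly, faithfully and symplectically. Let $H:\mathcal M\to\mathbb R$ be smooth and $\mathcal G$-invariant, with Hamiltonian vector field $f_H$ given by $\omega(f_H,\cdot)=\mathrm DH$. Suppose that there is a smooth momentum map $J:\mathcal M\to\mathfrak g^*$, i.e. $\omega(\xi x,\cdot)=\mathrm DJ_\xi(x)$ for all $\xi\in\mathfrak g$, and that it is coadjoint equivariant, $J(gx)=(\mathrm{Ad}_g^*)^{-1}J(x)$. Write $J^{\mathcal K}=(J^a,J^\theta)\in(\mathbb R^3\times\mathfrak{so}(2))^*=\mathfrak k^*$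 for its $\mathcal K$-components. Let $x_e$ be an axisymmetric relative equilibrium: for some $\xi_e\in\mathfrak g$ the curve $t\mapsto\exp(t\xi_e)x_e$ is a solution of $\dot x=f_H(x)$, and the isotropy subgroup of $x_e$ is $\{(\phi,0,\phi)\}$. Put $\nu_e=J^{\mathcal K}(x_e)$. By reduction coordinates at $x_e$ we mean smooth local coordinates $x=(a,\theta,\nu,w)$ around $x_e$, with $a\in\mathbb R^3$, $\theta\in\mathbb R$ (local angle), $\nu\in\mathfrak k^*$, $w\in\mathbb R^{\dim\mathcal M-8}$, of the form $x=(0,a,\theta)\cdot S(\nu,w)$ with $S(\nu_e,0)=x_e$ and $J^{\mathcal K}(S(\nu,w))=\nu$ for $(\nu,w)$ near $(\nu_e,0)$. In such coordinates $\mathcal K$ acts by translation of $(a,\theta)$, $w$ is a coordinate on the reduced space at momentum $\nu$, and $H=H(\nu,w):=H(S(\nu,w))$ is the reduced Hamiltonian. For $A\subseteq\mathcal G$, call $x_e$ $A$-stable if for every neighbourhood $N$ of $x_e$ in $\mathcal M$ there is a neighbourhood $V$ of $x_e$ in $\mathcal M$ such that every solution of $\dot x=f_H(x)$ starting in $V$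 exists for all times $t\in\mathbb R$ and stays in $A\cdot N=\{gy: g\in A,\ y\in N\}$. (Initial data in $V$ are arbitrary; in particular they may change the momentum.) **Proposition.** Reduction coordinates at $x_e$ exist. If in some reduction coordinates at $x_e$ the Hessian $\mathrm D_w^2H(\nu_e,0)$ is (positive or negative) definite, then $x_e$ is $\mathcal K$-stable, and hence also $\mathcal G$-stable. -/

import Mathlib

open scoped Manifold ContDiff Topology Pointwise

noncomputable section

/-! ### The symmetry group `(SO(2) ⋉ ℝ³) × SO(2)` -/

/-- Euclidean three-space. -/
abbrev E3 : Type := EuclideanSpace ℝ (Fin 3)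

/-- Rotation of `ℝ³` about the third axis by `z = e^{iφ}`, i.e. the matrix `exp(φ ê₃)`. -/
def rotZ (z : Circle) (a : E3) : E3 :=
  !₂[(z : ℂ).re * a 0 - (z : ℂ).im * a 1, (z : ℂ).im * a 0 + (z : ℂ).re * a 1, a 2]

/-- The set underlying the group `𝒢 = (SO(2) ⋉ ℝ³) × SO(2)`; an element is written `(φ, a, θ)`,
the rotations being represented by points of the unit circle. -/
def EuclSym : Type := Circle × E3 × Circle

namespace EuclSym

/-- The element `(φ, a, θ)`. -/
def mk (φ : Circle) (a : E3) (θ : Circle) : EuclSym := (φ, a, θ)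

/-- The left rotation component. -/
def rotL (g : EuclSym) : Circle := g.1

/-- The translation component. -/
def trans (g : EuclSym) : E3 := g.2.1

/-- The right rotation component. -/
def rotR (g : EuclSym) : Circle := g.2.2

theorem ext' {g h : EuclSym} (h1 : g.rotL = h.rotL) (h2 : g.trans = h.trans)
    (h3 : g.rotR = h.rotR) : g = h :=
  Prod.ext h1 (Prod.ext h2 h3)

instance : TopologicalSpace EuclSym :=
  inferInstanceAs (TopologicalSpace (Circle × E3 × Circle))

/-- The model space of the product manifold `S¹ × ℝ³ × S¹`. -/
abbrev Model : Type :=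
  ModelProd (EuclideanSpace ℝ (Fin 1)) (ModelProd E3 (EuclideanSpace ℝ (Fin 1)))

instance : ChartedSpace Model EuclSym :=
  inferInstanceAs (ChartedSpace Model (Circle × E3 × Circle))

/-- The model with corners of the product manifold `S¹ × ℝ³ × S¹`. -/
abbrev model : ModelWithCorners ℝ
    (EuclideanSpace ℝ (Fin 1) × E3 × EuclideanSpace ℝ (Fin 1)) Model :=
  (𝓡 1).prod (𝓘(ℝ, E3).prod (𝓡 1))

theorem rotZ_one (a : E3) : rotZ 1 a = a := by
  ext i; fin_cases i <;> simp [rotZ]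

theorem rotZ_mul (z w : Circle) (a : E3) : rotZ (z * w) a = rotZ z (rotZ w a) := by
  ext i; fin_cases i <;> simp [rotZ] <;> ring

theorem rotZ_add (z : Circle) (a b : E3) : rotZ z (a + b) = rotZ z a + rotZ z b := by
  ext i; fin_cases i <;> simp [rotZ] <;> ring

theorem rotZ_neg (z : Circle) (a : E3) : rotZ z (-a) = -rotZ z a := by
  ext i; fin_cases i <;> simp [rotZ] <;> ring

/-- `(φ₁, a₁, θ₁)(φ₂, a₂, θ₂) = (φ₁ + φ₂, a₁ + exp(φ₁ ê₃) a₂, θ₁ + θ₂)`, angles being added by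
multiplying points of the circle. -/
instance : Group EuclSym where
  mul g h := mk (g.rotL * h.rotL) (g.trans + rotZ g.rotL h.trans) (g.rotR * h.rotR)
  one := mk 1 0 1
  inv g := mk g.rotL⁻¹ (-rotZ g.rotL⁻¹ g.trans) g.rotR⁻¹
  mul_assoc g h k := by
    refine ext' (mul_assoc g.rotL h.rotL k.rotL) ?_ (mul_assoc g.rotR h.rotR k.rotR)
    change (g.trans + rotZ g.rotL h.trans) + rotZ (g.rotL * h.rotL) k.trans
      = g.trans + rotZ g.rotL (h.trans + rotZ h.rotL k.trans)
    rw [rotZ_mul, rotZ_add, add_assoc]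
  one_mul g := by
    refine ext' (one_mul g.rotL) ?_ (one_mul g.rotR)
    change 0 + rotZ 1 g.trans = g.trans
    rw [rotZ_one, zero_add]
  mul_one g := by
    refine ext' (mul_one g.rotL) ?_ (mul_one g.rotR)
    change g.trans + rotZ g.rotL 0 = g.trans
    have h : rotZ g.rotL (0 : E3) = 0 := by
      ext i; fin_cases i <;> simp [rotZ]
    rw [h, add_zero]
  inv_mul_cancel g := by
    refine ext' (inv_mul_cancel g.rotL) ?_ (inv_mul_cancel g.rotR)
    change -rotZ g.rotL⁻¹ g.trans + rotZ g.rotL⁻¹ g.trans = 0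
    exact neg_add_cancel _

theorem rotL_mul (g h : EuclSym) : (g * h).rotL = g.rotL * h.rotL := rfl

theorem trans_mul (g h : EuclSym) : (g * h).trans = g.trans + rotZ g.rotL h.trans := rfl

theorem rotR_mul (g h : EuclSym) : (g * h).rotR = g.rotR * h.rotR := rfl

/-- The diagonal subgroup `SO(2)_D = {(φ, 0, φ)}`. -/
def diag : Subgroup EuclSym where
  carrier := {g | g.trans = 0 ∧ g.rotL = g.rotR}
  one_mem' := ⟨rfl, rfl⟩
  mul_mem' := by
    rintro g h ⟨hg, hg'⟩ ⟨hh, hh'⟩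
    refine ⟨?_, ?_⟩
    · rw [trans_mul, hg, hh]
      ext i; fin_cases i <;> simp [rotZ]
    · rw [rotL_mul, rotR_mul, hg', hh']
  inv_mem' := by
    rintro g ⟨hg, hg'⟩
    refine ⟨?_, ?_⟩
    · change -rotZ g.rotL⁻¹ g.trans = 0
      rw [hg]
      ext i; fin_cases i <;> simp [rotZ]
    · change g.rotL⁻¹ = g.rotR⁻¹
      rw [hg']

/-- The abelian subgroup `𝒦 = ℝ³ × SO(2)_R = {(0, a, θ)}`. -/
def abel : Subgroup EuclSym where
  carrier := {g | g.rotL = 1}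
  one_mem' := rfl
  mul_mem' := by
    intro g h hg hh
    change g.rotL = 1 at hg
    change h.rotL = 1 at hh
    change g.rotL * h.rotL = 1
    rw [hg, hh, one_mul]
  inv_mem' := by
    intro g hg
    change g.rotL = 1 at hg
    change g.rotL⁻¹ = 1
    rw [hg, inv_one]

/-- The Lie algebra `𝔤 = so(2) ⊕ ℝ³ ⊕ so(2)`; an element is written `(ξ^φ, ξ^a, ξ^θ)`. -/
abbrev LieAlg : Type := ℝ × E3 × ℝ

/-- The dual `𝔤*`. -/
abbrev LieDual : Type := LieAlg →L[ℝ] ℝ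

/-- The exponential map `𝔤 → 𝒢`. -/
def exp (ξ : LieAlg) : EuclSym :=
  mk (Circle.exp ξ.1) (∫ s in (0 : ℝ)..1, rotZ (Circle.exp (s * ξ.1)) ξ.2.1) (Circle.exp ξ.2.2)

/-- The adjoint action: `Ad_g (ξ^φ, ξ^a, ξ^θ) = (ξ^φ, R ξ^a - ξ^φ e₃ × a, ξ^θ)` for `g = (φ, a, θ)`
and `R = exp(φ ê₃)`. -/
def Ad (g : EuclSym) (ξ : LieAlg) : LieAlg :=
  (ξ.1, rotZ g.rotL ξ.2.1 - ξ.1 • !₂[-(g.trans 1), g.trans 0, 0], ξ.2.2)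

end EuclSym

open EuclSym

variable {E : Type*} [NormedAddCommGroup E] [NormedSpace ℝ E]
  {M : Type*} [TopologicalSpace M] [ChartedSpace E M]

/-! ### Symplectic manifolds and Hamiltonian vector fields -/

/-- The expression of a two-form on `M` in the chart at `x₀`. -/
def formInChart (Ω : (x : M) → TangentSpace 𝓘(ℝ, E) x [⋀^Fin 2]→L[ℝ] ℝ) (x₀ : M) (y : E) :
    E [⋀^Fin 2]→L[ℝ] ℝ :=
  (Ω ((extChartAt 𝓘(ℝ, E) x₀).symm y)).compContinuousLinearMap
    (mfderiv 𝓘(ℝ, E) 𝓘(ℝ, E) (extChartAt 𝓘(ℝ, E) x₀).symm y)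

/-- The linear map `v ↦ B(v, ·)` of an alternating bilinear form. -/
def flatOf (B : E [⋀^Fin 2]→L[ℝ] ℝ) : E →ₗ[ℝ] Module.Dual ℝ E :=
  LinearMap.mk₂ ℝ (fun v w : E => B ![v, w])
    (fun v v' w => B.toMultilinearMap.cons_add ![w] v v')
    (fun c v w => B.toMultilinearMap.cons_smul ![w] c v)
    (fun v w w' => by
      have e (z : E) : Function.update ![v, 0] 1 z = ![v, z] := by
        ext i; fin_cases i <;> rfl
      have h := B.map_update_add ![v, 0] 1 w w'
      rw [e, e, e] at h
      exact h)
    (fun c v w => by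
      have e (z : E) : Function.update ![v, 0] 1 z = ![v, z] := by
        ext i; fin_cases i <;> rfl
      have h := B.map_update_smul ![v, 0] 1 c w
      rw [e, e] at h
      exact h)

variable (E M) in
/-- A symplectic form on `M`: a smooth, closed, nondegenerate two-form. -/
structure SymplecticForm where
  /-- The two-form. -/
  form : (x : M) → TangentSpace 𝓘(ℝ, E) x [⋀^Fin 2]→L[ℝ] ℝ
  smooth : ∀ x₀ : M, ContDiffOn ℝ ∞ (formInChart form x₀) (extChartAt 𝓘(ℝ, E) x₀).target
  closed : ∀ x₀ : M, ∀ y ∈ (extChartAt 𝓘(ℝ, E) x₀).target, extDeriv (formInChart form x₀) y = 0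
  nondegenerate : ∀ (x : M) (v : TangentSpace 𝓘(ℝ, E) x), (∀ w, form x ![v, w] = 0) → v = 0

namespace SymplecticForm

/-- The linear map `v ↦ Ω(x)(v, ·)`. -/
def flat (Ω : SymplecticForm E M) (x : M) : E →ₗ[ℝ] Module.Dual ℝ E :=
  flatOf (Ω.form x)

theorem flat_injective (Ω : SymplecticForm E M) (x : M) : Function.Injective (Ω.flat x) := by
  rw [← LinearMap.ker_eq_bot, LinearMap.ker_eq_bot']
  intro v hv
  exact Ω.nondegenerate x v fun w => LinearMap.congr_fun hv w

variable [FiniteDimensional ℝ E]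

/-- The Hamiltonian vector field `f_H`. -/
def hamVF (Ω : SymplecticForm E M) (H : M → ℝ) (x : M) : TangentSpace 𝓘(ℝ, E) x :=
  (LinearMap.linearEquivOfInjective (Ω.flat x) (Ω.flat_injective x)
    Subspace.dual_finrank_eq.symm).symm (mfderiv 𝓘(ℝ, E) 𝓘(ℝ, ℝ) H x : E →L[ℝ] ℝ).toLinearMap

/-- The defining property `Ω(x)(f_H(x), w) = DH(x) w`. -/
theorem form_hamVF (Ω : SymplecticForm E M) (H : M → ℝ) (x : M)
    (w : TangentSpace 𝓘(ℝ, E) x) :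
    Ω.form x ![Ω.hamVF H x, w] = mfderiv 𝓘(ℝ, E) 𝓘(ℝ, ℝ) H x w := by
  have h : Ω.flat x (Ω.hamVF H x) = (mfderiv 𝓘(ℝ, E) 𝓘(ℝ, ℝ) H x : E →L[ℝ] ℝ).toLinearMap :=
    (LinearMap.linearEquivOfInjective (Ω.flat x) (Ω.flat_injective x)
      Subspace.dual_finrank_eq.symm).apply_symm_apply _
  exact LinearMap.congr_fun h w

end SymplecticForm

/-! ### Symmetry, momentum map, relative equilibria, stability -/

variable [MulAction EuclSym M]

/-- `𝒢` acts by symplectic transformations. -/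
def IsSymplecticAction (Ω : SymplecticForm E M) : Prop :=
  ∀ (g : EuclSym) (x : M) (u v : TangentSpace 𝓘(ℝ, E) x),
    Ω.form (g • x) ![mfderiv 𝓘(ℝ, E) 𝓘(ℝ, E) (fun y : M => g • y) x u,
      mfderiv 𝓘(ℝ, E) 𝓘(ℝ, E) (fun y : M => g • y) x v] = Ω.form x ![u, v]

variable (E) in
/-- The infinitesimal generator `ξ x = d/dt exp(tξ) x` at `t = 0`. -/
def infGen (ξ : LieAlg) (x : M) : TangentSpace 𝓘(ℝ, E) x :=
  (mfderiv 𝓘(ℝ, ℝ) 𝓘(ℝ, E) (fun t : ℝ => EuclSym.exp (t • ξ) • x) 0 : ℝ →L[ℝ] E) (1 : ℝ)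

/-- `J : M → 𝔤*` is a momentum map of the action: `Ω(x)(ξ x, w) = D J_ξ(x) w`. -/
def IsMomentumMap (Ω : SymplecticForm E M) (J : M → LieDual) : Prop :=
  ∀ (ξ : LieAlg) (x : M) (w : TangentSpace 𝓘(ℝ, E) x),
    Ω.form x ![infGen E ξ x, w] = mfderiv 𝓘(ℝ, E) 𝓘(ℝ, ℝ) (fun y => J y ξ) x w

/-- `J(g x) = (Ad_g^*)⁻¹ J(x)`, where `(Ad_g^* μ)(ξ) = μ(Ad_g ξ)`. -/
def IsCoadjointEquivariant (J : M → LieDual) : Prop :=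
  ∀ (g : EuclSym) (x : M) (ξ : LieAlg), J (g • x) (Ad g ξ) = J x ξ

/-- `x_e` is a relative equilibrium of the vector field `f`: for some `ξ_e ∈ 𝔤` the curve
`exp(ξ_e t) x_e` is a solution. -/
def IsRelativeEquilibrium (f : (x : M) → TangentSpace 𝓘(ℝ, E) x) (xe : M) : Prop :=
  ∃ ξ : LieAlg, IsMIntegralCurve (fun t : ℝ => EuclSym.exp (t • ξ) • xe) f

/-- A relative equilibrium is axisymmetric if its isotropy subgroup is `SO(2)_D`. -/
def IsAxisymmetric (xe : M) : Prop :=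
  MulAction.stabilizer EuclSym xe = EuclSym.diag

/-- `A`-stability of `x_e` for a subset `A` of `𝒢`: solutions starting sufficiently close to `x_e`
exist for all times and stay arbitrarily close to `A x_e`. Closeness to the (in general noncompact)
set `A x_e` is uniform along the action, i.e. measured by the sets `A • N` for neighbourhoods `N`
of `x_e`. -/
def IsStableModulo (f : (x : M) → TangentSpace 𝓘(ℝ, E) x) (A : Set EuclSym) (xe : M) : Prop :=
  ∀ N ∈ 𝓝 xe, ∃ V ∈ 𝓝 xe, ∀ x ∈ V, ∃ γ : ℝ → M,
    γ 0 = x ∧ IsMIntegralCurve γ f ∧ ∀ t : ℝ, γ t ∈ A • N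

/-! ### The reduced system -/

/-- `𝔨* = (ℝ³ × so(2))*`; an element is written `ν = (ν^a, ν^θ)`. -/
abbrev KDual : Type := E3 × ℝ

/-- The momentum map `J^𝒦 = (J^a, J^θ)` of the subgroup `𝒦`. -/
def JK (J : M → LieDual) (x : M) : KDual :=
  (!₂[J x (0, EuclideanSpace.single 0 1, 0), J x (0, EuclideanSpace.single 1 1, 0),
    J x (0, EuclideanSpace.single 2 1, 0)], J x (0, 0, 1))

variable (E) in
/-- The space `W = ℝ^(dim M - 8)`. (At an axisymmetric point of a symplectic `𝒢`-manifold the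
`𝒦`-orbit is four-dimensional and isotropic, so that `dim M ≥ 8`.) -/
abbrev WSpace : Type := EuclideanSpace ℝ (Fin (Module.finrank ℝ E - 8))

variable (E) in
/-- Coordinates `x = (a, θ, ν, w)` around `x_e` adapted to the reduction by `𝒦`: the group `𝒦` acts
by translation of `(a, θ)`, `ν = (J^a, J^θ)`, and `x_e` has coordinates `(0, 0, ν_e, 0)`. They are
given by the slice `a = 0, θ = 0`, parametrized by `(ν, w)`, which is a local model of `M / 𝒦`; the
subset `ν = const` of the slice is a local model of the reduced space at momentum `ν`. The
coordinates `w` are not required to be canonical on these reduced spaces: coordinates in which they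
are canonical are a special case. -/
structure ReductionCoordinates (J : M → LieDual) (xe : M) where
  /-- The parametrization of the slice. -/
  slice : KDual → WSpace E → M
  slice_base : slice (JK J xe) 0 = xe
  momentum : ∀ᶠ p : KDual × WSpace E in 𝓝 (JK J xe, 0), JK J (slice p.1 p.2) = p.1
  localDiffeo : IsLocalDiffeomorphAt 𝓘(ℝ, (E3 × ℝ) × KDual × WSpace E) 𝓘(ℝ, E) ∞
    (fun p : (E3 × ℝ) × KDual × WSpace E =>
      EuclSym.mk 1 p.1.1 (Circle.exp p.1.2) • slice p.2.1 p.2.2)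
    ((0, 0), JK J xe, 0)

/-- The reduced Hamiltonian `H(ν, w)`: the `𝒦`-invariant function `H` in the coordinates
`(a, θ, ν, w)`. -/
def ReductionCoordinates.redHam {J : M → LieDual} {xe : M} (c : ReductionCoordinates E J xe)
    (H : M → ℝ) (ν : KDual) (w : WSpace E) : ℝ :=
  H (c.slice ν w)

/-- The Hessian `D_w² H(ν_e, 0)` of the reduced Hamiltonian. -/
def ReductionCoordinates.hessian {J : M → LieDual} {xe : M} (c : ReductionCoordinates E J xe)
    (H : M → ℝ) (u v : WSpace E) : ℝ :=
  iteratedFDeriv ℝ 2 (fun w => c.redHam H (JK J xe) w) 0 ![u, v]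

/-- `D_w² H(ν_e, 0)` is (positive or negative) definite. -/
def ReductionCoordinates.HessianDefinite {J : M → LieDual} {xe : M}
    (c : ReductionCoordinates E J xe) (H : M → ℝ) : Prop :=
  (∀ v : WSpace E, v ≠ 0 → 0 < c.hessian H v v) ∨
    (∀ v : WSpace E, v ≠ 0 → c.hessian H v v < 0)

end

/-!
`H` and `J^𝒦` are constant along solutions, and `J^𝒦` is `𝒦`-invariant because `𝒦` is abelian. In
reduction coordinates these conserved quantities read `(ν, H(ν, w))`, so a solution can move in `w`
only inside a level set of `H(ν, ·)`.

*Stability.* At a relative equilibrium `DH = DJ_ξ` for some `ξ ∈ 𝔤`. The generator of the isotropy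
group `SO(2)_D` vanishes at `x_e`, so `ξ` can be moved into `𝔨` without changing `DJ_ξ(x_e)`
(`IsAxisymmetric.exists_mfderiv_sub_eq_zero`); as `J_ξ` is constant on the part `ν = ν_e` of the
slice, `w = 0` is a critical point of `H(ν_e, ·)`. If the Hessian is definite, it is a strict local
extremum, and comparison with the values on a compact shell around `0` confines the level sets of
`H(ν, ·)` also for `ν` near `ν_e` (`exists_nhds_forall_mem_of_eq`). This bounds `w` but not the
position on the noncompact orbit of `𝒦`. However, the Hamiltonian vector field is `C¹`, so solutions
near `x_e` exist for a common time and do not leave the coordinate domain during it, and `𝒦` maps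
solutions to solutions. Hence the part of a level set of `(J^𝒦, H)` that meets `𝒦 U`, for a small
neighbourhood `U` of `x_e`, contains a piece of solution of uniform length through each of its
points, and these pieces join to global solutions that remain in `𝒦 U`
(`exists_isMIntegralCurve_mem_of_uniform`).

*Reduction coordinates.* The isotropy group of `x_e` meets `𝒦` trivially, so no generator of `𝔨`
vanishes at `x_e`. It follows that the orbit map of `𝒦` is immersive at `x_e`, and, by nondegeneracy
of the symplectic form, that `J^𝒦` is submersive there. The tangent space of the orbit lies in
`ker DJ^𝒦`, by invariance of `J^𝒦`. A frame adapted to this flag gives an affine slice in a chart,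
and two applications of the inverse function theorem turn it into reduction coordinates
(`exists_reductionCoordinates`).
-/

open EuclSym

/-! ### Integral curves of uniform length -/

section IntegralCurves

open Set

variable {E : Type*} [NormedAddCommGroup E] [NormedSpace ℝ E]
  {M : Type*} [TopologicalSpace M] [ChartedSpace E M]

/-- A differentiable curve in the chart at `x₀` that solves the chart expression of the vector
field `v` is, read on the manifold, an integral curve. -/
theorem hasMFDerivAt_extChartAt_symm_comp [IsManifold 𝓘(ℝ, E) 1 M]
    {v : (x : M) → TangentSpace 𝓘(ℝ, E) x} {x₀ : M} {f : ℝ → E} {t : ℝ}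
    (ht : f t ∈ (extChartAt 𝓘(ℝ, E) x₀).target)
    (h : HasDerivAt f (tangentCoordChange 𝓘(ℝ, E) ((extChartAt 𝓘(ℝ, E) x₀).symm (f t)) x₀
      ((extChartAt 𝓘(ℝ, E) x₀).symm (f t)) (v ((extChartAt 𝓘(ℝ, E) x₀).symm (f t)))) t) :
    HasMFDerivAt 𝓘(ℝ, ℝ) 𝓘(ℝ, E) ((extChartAt 𝓘(ℝ, E) x₀).symm ∘ f) t
      ((1 : ℝ →L[ℝ] ℝ).smulRight (v (((extChartAt 𝓘(ℝ, E) x₀).symm ∘ f) t))) := by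
  let xₜ : M := (extChartAt 𝓘(ℝ, E) x₀).symm (f t)
  have hft1 : xₜ ∈ (extChartAt 𝓘(ℝ, E) x₀).source := (extChartAt 𝓘(ℝ, E) x₀).map_target ht
  have hft2 := mem_extChartAt_source (I := 𝓘(ℝ, E)) xₜ
  have key : HasDerivAt ((extChartAt 𝓘(ℝ, E) xₜ ∘ (extChartAt 𝓘(ℝ, E) x₀).symm) ∘ f)
      (v xₜ : E) t := by
    have e : tangentCoordChange 𝓘(ℝ, E) x₀ xₜ xₜ (tangentCoordChange 𝓘(ℝ, E) xₜ x₀ xₜ (v xₜ)) =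
        v xₜ := by
      refine (tangentCoordChange_comp (x := x₀) ⟨⟨hft2, hft1⟩, hft2⟩).trans ?_
      exact tangentCoordChange_self hft2
    refine HasDerivAt.congr_deriv (f' := tangentCoordChange 𝓘(ℝ, E) x₀ xₜ xₜ
      (tangentCoordChange 𝓘(ℝ, E) xₜ x₀ xₜ (v xₜ) : E)) ?_ e
    apply HasFDerivAt.comp_hasDerivAt _ _ h
    have := hasFDerivWithinAt_tangentCoordChange (I := 𝓘(ℝ, E)) (x := x₀) (y := xₜ) ⟨hft1, hft2⟩
    rw [(extChartAt 𝓘(ℝ, E) x₀).right_inv ht] at this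
    exact HasFDerivWithinAt.hasFDerivAt this (by simp)
  exact ⟨(continuousAt_extChartAt_symm'' ht).comp h.continuousAt,
    key.hasFDerivAt.hasFDerivWithinAt⟩

/-- Local existence with a uniform time: all integral curves of a `C¹` vector field that start
near `x₀` exist, and remain in a given neighbourhood of `x₀`, for a common time. -/
theorem exists_uniform_isMIntegralCurveOn [CompleteSpace E] [IsManifold 𝓘(ℝ, E) 1 M]
    {v : (x : M) → TangentSpace 𝓘(ℝ, E) x} {x₀ : M}
    (hv : CMDiffAt 1 (fun x ↦ (⟨x, v x⟩ : TangentBundle 𝓘(ℝ, E) M)) x₀)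
    {W : Set M} (hW : W ∈ 𝓝 x₀) :
    ∃ U ∈ 𝓝 x₀, ∃ ε > (0 : ℝ), ∀ x ∈ U, ∃ γ : ℝ → M, γ 0 = x ∧
      IsMIntegralCurveOn γ v (Ioo (-ε) ε) ∧ ∀ t ∈ Ioo (-ε) ε, γ t ∈ W := by
  rw [contMDiffAt_iff] at hv
  obtain ⟨_, hv⟩ := hv
  have hv' := (hv.contDiffAt (by simp)).snd
  obtain ⟨ε, hε, a, r, K, K', hr, hpl⟩ := IsPicardLindelof.of_contDiffAt_one hv'
  obtain ⟨α, hα, hαc⟩ := (hpl 0).exists_forall_mem_closedBall_eq_hasDerivWithinAt_continuousOn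
  set φ := extChartAt 𝓘(ℝ, E) x₀ with hφ
  have hbase : φ x₀ ∈ φ.target := mem_extChartAt_target x₀
  have htgt : φ.target ∈ 𝓝 (φ x₀) := extChartAt_target_mem_nhds x₀
  -- the set of chart points that stand for points of `W`
  have hWn : φ.target ∩ φ.symm ⁻¹' W ∈ 𝓝 (φ x₀) := by
    refine Filter.inter_mem htgt ((continuousAt_extChartAt_symm x₀).preimage_mem_nhds ?_)
    rwa [← hφ, φ.left_inv (mem_extChartAt_source x₀)]
  have hr' : (0 : ℝ) < r := hr
  have hαat : ContinuousAt α (φ x₀, 0) := hαc.continuousAt <| prod_mem_nhds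
    (Metric.closedBall_mem_nhds _ hr') (Icc_mem_nhds (by linarith) (by linarith))
  have hα0 : α (φ x₀, 0) = φ x₀ := (hα _ (Metric.mem_closedBall_self hr'.le)).1
  have hpre := hαat.preimage_mem_nhds (t := φ.target ∩ φ.symm ⁻¹' W) (by rwa [hα0])
  rw [nhds_prod_eq, Filter.mem_prod_iff] at hpre
  obtain ⟨U₁, hU₁, T, hT, hUT⟩ := hpre
  obtain ⟨δ, hδ, hδT⟩ := Metric.mem_nhds_iff.mp hT
  refine ⟨φ.source ∩ φ ⁻¹' (U₁ ∩ Metric.closedBall (φ x₀) r), ?_, min δ ε, lt_min hδ hε, ?_⟩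
  · exact Filter.inter_mem (extChartAt_source_mem_nhds x₀)
      ((continuousAt_extChartAt x₀).preimage_mem_nhds
        (Filter.inter_mem hU₁ (Metric.closedBall_mem_nhds _ hr')))
  rintro x ⟨hxs, hxU, hxr⟩
  have hmem : ∀ t ∈ Ioo (-(min δ ε)) (min δ ε), α (φ x, t) ∈ φ.target ∩ φ.symm ⁻¹' W := by
    intro t ht
    refine hUT (Set.mk_mem_prod hxU (hδT ?_))
    rw [Metric.mem_ball, Real.dist_eq, sub_zero, abs_lt]
    exact ⟨by linarith [ht.1, min_le_left δ ε], by linarith [ht.2, min_le_left δ ε]⟩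
  refine ⟨φ.symm ∘ fun t => α (φ x, t), ?_, ?_, fun t ht => (hmem t ht).2⟩
  · rw [Function.comp_apply, (hα _ hxr).1, φ.left_inv hxs]
  · intro t ht
    refine (hasMFDerivAt_extChartAt_symm_comp (hmem t ht).1 ?_).hasMFDerivWithinAt
    have ht1 : 0 - ε < t := by linarith [ht.1, min_le_right δ ε]
    have ht2 : t < 0 + ε := by linarith [ht.2, min_le_right δ ε]
    exact ((hα _ hxr).2 t ⟨ht1.le, ht2.le⟩).hasDerivAt (Icc_mem_nhds ht1 ht2)

/-- If every point of a set `A` has an integral curve inside `A` on a time interval of fixed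
length, then it has a global integral curve inside `A`. -/
theorem exists_isMIntegralCurve_mem_of_uniform [IsManifold 𝓘(ℝ, E) 1 M] [T2Space M]
    {v : (x : M) → TangentSpace 𝓘(ℝ, E) x}
    (hv : CMDiff 1 (fun x ↦ (⟨x, v x⟩ : TangentBundle 𝓘(ℝ, E) M)))
    {A : Set M} {ε : ℝ} (hε : 0 < ε)
    (h : ∀ x ∈ A, ∃ γ : ℝ → M, γ 0 = x ∧ IsMIntegralCurveOn γ v (Ioo (-ε) ε) ∧
      ∀ t ∈ Ioo (-ε) ε, γ t ∈ A) {x : M} (hx : x ∈ A) :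
    ∃ γ : ℝ → M, γ 0 = x ∧ IsMIntegralCurve γ v ∧ ∀ t, γ t ∈ A := by
  -- existence on `(-s, s)` implies existence on `(-(s + ε / 2), s + ε / 2)` if `ε ≤ s`
  have step : ∀ n : ℕ, ∃ γ : ℝ → M, γ 0 = x ∧
      IsMIntegralCurveOn γ v (Ioo (-(ε + n * (ε / 2))) (ε + n * (ε / 2))) ∧
      ∀ t ∈ Ioo (-(ε + n * (ε / 2))) (ε + n * (ε / 2)), γ t ∈ A := by
    intro n
    induction n with
    | zero => simpa using h x hx
    | succ n ih =>
      obtain ⟨γ, h0, hγ, hA⟩ := ih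
      set s : ℝ := ε + n * (ε / 2) with hs
      have hsε : ε ≤ s := le_add_of_nonneg_right (by positivity)
      have hs' : ε + ((n + 1 : ℕ) : ℝ) * (ε / 2) = s + ε / 2 := by rw [hs]; push_cast; ring
      rw [hs']
      obtain ⟨α, α0, hα, αA⟩ := h _ (hA (-(s - ε / 2)) ⟨by linarith, by linarith⟩)
      obtain ⟨β, β0, hβ, βA⟩ := h _ (hA (s - ε / 2) ⟨by linarith, by linarith⟩)
      rw [← isMIntegralCurveOn_comp_add (dt := s - ε / 2)] at hα
      rw [← isMIntegralCurveOn_comp_sub (dt := s - ε / 2)] at hβ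
      simp_rw [Set.mem_Ioo, ← sub_lt_iff_lt_add, ← lt_sub_iff_add_lt, ← Set.mem_Ioo] at hα
      simp_rw [Set.mem_Ioo, lt_sub_iff_add_lt, sub_lt_iff_lt_add, ← Set.mem_Ioo] at hβ
      have h1 := isMIntegralCurveOn_piecewise (t₀ := -(s - ε / 2)) hv hγ hα
        ⟨⟨by linarith, by linarith⟩, ⟨by linarith, by linarith⟩⟩ (by simp [α0])
      have h2 := isMIntegralCurveOn_piecewise (t₀ := s - ε / 2) hv
        (h1.mono (s' := Ioo (-(s + ε / 2)) s) fun t ht => (le_or_gt t (-s)).elim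
          (fun h => .inr ⟨by linarith [ht.1], by linarith⟩) (fun h => .inl ⟨h, ht.2⟩)) hβ
        ⟨⟨by linarith, by linarith⟩, ⟨by linarith, by linarith⟩⟩
        (by rw [piecewise, if_pos ⟨by linarith, by linarith⟩]; simp [β0])
      refine ⟨_, ?_, h2.mono (Ioo_subset_Ioo_union_Ioo (by linarith) (by linarith)
        (by linarith)), ?_⟩
      · rw [piecewise, if_pos ⟨by linarith, by linarith⟩, piecewise,
          if_pos ⟨by linarith, by linarith⟩, h0]
      · intro t ht
        rw [piecewise]
        split_ifs with c1
        · rw [piecewise]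
          split_ifs with c2
          · exact hA t c2
          · refine αA _ ⟨by linarith [ht.1], ?_⟩
            by_contra hcon
            exact c2 ⟨by linarith, c1.2⟩
        · refine βA _ ⟨?_, by linarith [ht.2]⟩
          by_contra hcon
          exact c1 ⟨ht.1, by linarith⟩
  have large : ∀ a : ℝ, ∃ n : ℕ, a ≤ ε + n * (ε / 2) := by
    intro a
    obtain ⟨n, hn⟩ := exists_nat_ge (a / (ε / 2))
    refine ⟨n, ?_⟩
    rw [div_le_iff₀ (by positivity)] at hn
    linarith
  obtain ⟨γ, h0, hγ⟩ := (exists_isMIntegralCurve_iff_exists_isMIntegralCurveOn_Ioo hv x).2 <| by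
    intro a
    obtain ⟨n, hn⟩ := large a
    obtain ⟨γ, h0, hγ, -⟩ := step n
    exact ⟨γ, h0, hγ.mono (Ioo_subset_Ioo (neg_le_neg hn) hn)⟩
  refine ⟨γ, h0, hγ, fun t => ?_⟩
  obtain ⟨n, hn⟩ := large (|t| + 1)
  obtain ⟨γ', h0', hγ', hA'⟩ := step n
  have hpos : 0 < ε + n * (ε / 2) := by positivity
  have ht : t ∈ Ioo (-(ε + n * (ε / 2))) (ε + n * (ε / 2)) := abs_lt.mp (by linarith)
  rw [isMIntegralCurveOn_Ioo_eqOn_of_contMDiff_boundaryless ⟨neg_lt_zero.mpr hpos, hpos⟩ hv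
    (hγ.isMIntegralCurveOn _) hγ' (h0.trans h0'.symm) ht]
  exact hA' t ht

end IntegralCurves

/-! ### Smoothness of Hamiltonian vector fields -/

section HamiltonianVectorField

open Set

variable {E : Type*} [NormedAddCommGroup E] [NormedSpace ℝ E]
  {M : Type*} [TopologicalSpace M] [ChartedSpace E M]

/-- The map `B ↦ (v ↦ B(v, ·))`, as a continuous linear map on alternating bilinear forms. -/
noncomputable def flatCLM : (E [⋀^Fin 2]→L[ℝ] ℝ) →L[ℝ] E →L[ℝ] E →L[ℝ] ℝ :=
  (ContinuousLinearMap.compL ℝ E (E [⋀^Fin 1]→L[ℝ] ℝ) (E →L[ℝ] ℝ)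
    (ContinuousAlternatingMap.ofSubsingletonLIE (𝕜 := ℝ) (E := E) (F := ℝ)
      (0 : Fin 1)).symm.toContinuousLinearEquiv.toContinuousLinearMap).comp
    (ContinuousAlternatingMap.curryLeftLI (𝕜 := ℝ) (E := E) (F := ℝ) (n := 1)).toContinuousLinearMap

theorem flatCLM_apply (B : E [⋀^Fin 2]→L[ℝ] ℝ) (v w : E) : flatCLM B v w = B ![v, w] := by
  change B _ = _
  congr 1
  ext i
  fin_cases i <;> rfl

theorem isInvertible_flatCLM [FiniteDimensional ℝ E] {B : E [⋀^Fin 2]→L[ℝ] ℝ}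
    (hB : ∀ v, (∀ w, B ![v, w] = 0) → v = 0) : (flatCLM B).IsInvertible := by
  have hinj : Function.Injective (flatCLM B : E →ₗ[ℝ] E →L[ℝ] ℝ) := by
    rw [← LinearMap.ker_eq_bot, LinearMap.ker_eq_bot']
    intro v hv
    refine hB v fun w => ?_
    rw [← flatCLM_apply]
    exact congrArg (fun f : E →L[ℝ] ℝ => f w) hv
  have hfin : Module.finrank ℝ E = Module.finrank ℝ (E →L[ℝ] ℝ) := by
    rw [← (LinearMap.toContinuousLinearMap (𝕜 := ℝ) (E := E) (F' := ℝ)).finrank_eq]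
    exact Subspace.dual_finrank_eq.symm
  refine ⟨(LinearMap.linearEquivOfInjective _ hinj hfin).toContinuousLinearEquiv, ?_⟩
  ext v w
  rfl

theorem formInChart_apply (Ω : (x : M) → TangentSpace 𝓘(ℝ, E) x [⋀^Fin 2]→L[ℝ] ℝ) (x₀ : M)
    (y v w : E) : formInChart Ω x₀ y ![v, w] = Ω ((extChartAt 𝓘(ℝ, E) x₀).symm y)
      ![mfderiv 𝓘(ℝ, E) 𝓘(ℝ, E) (extChartAt 𝓘(ℝ, E) x₀).symm y v,
        mfderiv 𝓘(ℝ, E) 𝓘(ℝ, E) (extChartAt 𝓘(ℝ, E) x₀).symm y w] := by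
  change Ω _ _ = Ω _ _
  congr 1
  ext i
  fin_cases i <;> rfl

/-- The Hamiltonian vector field is characterized by `Ω(x)(f, ·) = DH(x)`. -/
theorem SymplecticForm.eq_hamVF [FiniteDimensional ℝ E] (Ω : SymplecticForm E M) (H : M → ℝ) (x : M)
    (u : TangentSpace 𝓘(ℝ, E) x)
    (h : ∀ w, Ω.form x ![u, w] = mfderiv 𝓘(ℝ, E) 𝓘(ℝ, ℝ) H x w) : u = Ω.hamVF H x := by
  apply Ω.flat_injective x
  ext w
  exact (h w).trans (Ω.form_hamVF H x w).symm

/-- The Hamiltonian is infinitesimally conserved. -/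
theorem SymplecticForm.mfderiv_hamVF_self [FiniteDimensional ℝ E] (Ω : SymplecticForm E M)
    (H : M → ℝ) (x : M) :
    mfderiv 𝓘(ℝ, E) 𝓘(ℝ, ℝ) H x (Ω.hamVF H x) = 0 :=
  (Ω.form_hamVF H x _).symm.trans
    ((Ω.form x).map_eq_zero_of_eq _ (i := 0) (j := 1) rfl (by decide))

variable [IsManifold 𝓘(ℝ, E) ∞ M]

theorem mfderiv_extChartAt_symm_mfderiv {x₀ x : M} (hx : x ∈ (extChartAt 𝓘(ℝ, E) x₀).source)
    (v : E) :
    (mfderiv 𝓘(ℝ, E) 𝓘(ℝ, E) (extChartAt 𝓘(ℝ, E) x₀).symm (extChartAt 𝓘(ℝ, E) x₀ x) : E →L[ℝ] E)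
      ((mfderiv 𝓘(ℝ, E) 𝓘(ℝ, E) (extChartAt 𝓘(ℝ, E) x₀) x : E →L[ℝ] E) v) = v := by
  have : IsManifold 𝓘(ℝ, E) 1 M := .of_le (n := ∞) (by simp)
  have h := mfderivWithin_extChartAt_symm_comp_mfderiv_extChartAt' (I := 𝓘(ℝ, E)) hx
  rw [ModelWithCorners.range_eq_univ, mfderivWithin_univ] at h
  exact congrArg (fun f : E →L[ℝ] E => f v) h

theorem mfderiv_extChartAt_mfderiv_symm {x₀ : M} {y : E}
    (hy : y ∈ (extChartAt 𝓘(ℝ, E) x₀).target) (v : E) :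
    (mfderiv 𝓘(ℝ, E) 𝓘(ℝ, E) (extChartAt 𝓘(ℝ, E) x₀) ((extChartAt 𝓘(ℝ, E) x₀).symm y) : E →L[ℝ] E)
      ((mfderiv 𝓘(ℝ, E) 𝓘(ℝ, E) (extChartAt 𝓘(ℝ, E) x₀).symm y : E →L[ℝ] E) v) = v := by
  have : IsManifold 𝓘(ℝ, E) 1 M := .of_le (n := ∞) (by simp)
  have h := mfderiv_extChartAt_comp_mfderivWithin_extChartAt_symm (I := 𝓘(ℝ, E)) hy
  rw [ModelWithCorners.range_eq_univ, mfderivWithin_univ] at h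
  exact congrArg (fun f : E →L[ℝ] E => f v) h

theorem formInChart_apply_mfderiv (Ω : (x : M) → TangentSpace 𝓘(ℝ, E) x [⋀^Fin 2]→L[ℝ] ℝ)
    {x₀ : M} {y : E} (hy : y ∈ (extChartAt 𝓘(ℝ, E) x₀).target) (v w : E) :
    formInChart Ω x₀ y ![v, (mfderiv 𝓘(ℝ, E) 𝓘(ℝ, E) (extChartAt 𝓘(ℝ, E) x₀)
        ((extChartAt 𝓘(ℝ, E) x₀).symm y) : E →L[ℝ] E) w] =
      Ω ((extChartAt 𝓘(ℝ, E) x₀).symm y)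
        ![mfderiv 𝓘(ℝ, E) 𝓘(ℝ, E) (extChartAt 𝓘(ℝ, E) x₀).symm y v, w] := by
  have h2 := mfderiv_extChartAt_symm_mfderiv ((extChartAt 𝓘(ℝ, E) x₀).map_target hy) w
  rw [(extChartAt 𝓘(ℝ, E) x₀).right_inv hy] at h2
  exact (formInChart_apply Ω x₀ y v _).trans (congrArg (fun z : E =>
    Ω ((extChartAt 𝓘(ℝ, E) x₀).symm y)
      ![mfderiv 𝓘(ℝ, E) 𝓘(ℝ, E) (extChartAt 𝓘(ℝ, E) x₀).symm y v, z]) h2)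

theorem SymplecticForm.isInvertible_flatCLM_formInChart [FiniteDimensional ℝ E]
    (Ω : SymplecticForm E M) {x₀ : M} {y : E} (hy : y ∈ (extChartAt 𝓘(ℝ, E) x₀).target) :
    (flatCLM (formInChart Ω.form x₀ y)).IsInvertible := by
  refine isInvertible_flatCLM fun v hv => ?_
  have h0 := Ω.nondegenerate ((extChartAt 𝓘(ℝ, E) x₀).symm y)
    (mfderiv 𝓘(ℝ, E) 𝓘(ℝ, E) (extChartAt 𝓘(ℝ, E) x₀).symm y v) fun w =>
      (formInChart_apply_mfderiv Ω.form hy v w).symm.trans (hv _)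
  have h3 := mfderiv_extChartAt_mfderiv_symm hy v
  rw [← h3]
  exact (congrArg _ h0).trans (map_zero _)

theorem contDiffOn_comp_extChartAt_symm {F : Type*} [NormedAddCommGroup F] [NormedSpace ℝ F]
    {H : M → F} (hH : ContMDiff 𝓘(ℝ, E) 𝓘(ℝ, F) ∞ H) (x₀ : M) :
    ContDiffOn ℝ ∞ (H ∘ (extChartAt 𝓘(ℝ, E) x₀).symm) (extChartAt 𝓘(ℝ, E) x₀).target := by
  rw [← contMDiffOn_iff_contDiffOn]
  exact hH.comp_contMDiffOn (contMDiffOn_extChartAt_symm x₀)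

variable [FiniteDimensional ℝ E]

/-- The Hamiltonian vector field in the chart at `x₀`. -/
noncomputable def SymplecticForm.hamVFInChart (Ω : SymplecticForm E M) (H : M → ℝ) (x₀ : M)
    (y : E) : E :=
  (flatCLM (formInChart Ω.form x₀ y)).inverse
    (fderiv ℝ (H ∘ (extChartAt 𝓘(ℝ, E) x₀).symm) y)

theorem SymplecticForm.contDiffAt_hamVFInChart (Ω : SymplecticForm E M) {H : M → ℝ}
    (hH : ContMDiff 𝓘(ℝ, E) 𝓘(ℝ, ℝ) ∞ H) {x₀ : M} {y : E}
    (hy : y ∈ (extChartAt 𝓘(ℝ, E) x₀).target) : ContDiffAt ℝ 1 (Ω.hamVFInChart H x₀) y := by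
  have : CompleteSpace E := FiniteDimensional.complete ℝ E
  have hn : (extChartAt 𝓘(ℝ, E) x₀).target ∈ 𝓝 y := (isOpen_extChartAt_target x₀).mem_nhds hy
  have h1 : ContDiffAt ℝ 1 (formInChart Ω.form x₀) y :=
    ((Ω.smooth x₀).contDiffAt hn).of_le (by simp)
  have h0 : ContDiff ℝ 1 (fun B : E [⋀^Fin 2]→L[ℝ] ℝ => flatCLM B) :=
    ContinuousLinearMap.contDiff _
  have h2 : ContDiffAt ℝ 1 (fun z => flatCLM (formInChart Ω.form x₀ z)) y :=
    ContDiffAt.comp (g := fun B : E [⋀^Fin 2]→L[ℝ] ℝ => flatCLM B) y h0.contDiffAt h1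
  have h3 : ContDiffAt ℝ 1 (fun z => (flatCLM (formInChart Ω.form x₀ z)).inverse) y :=
    ContDiffAt.comp (g := ContinuousLinearMap.inverse) y
      (Ω.isInvertible_flatCLM_formInChart hy).contDiffAt_map_inverse h2
  exact h3.clm_apply (((contDiffOn_comp_extChartAt_symm hH x₀).contDiffAt hn).fderiv_right
    (by norm_cast))

theorem SymplecticForm.hamVF_eq_hamVFInChart (Ω : SymplecticForm E M) {H : M → ℝ}
    (hH : ContMDiff 𝓘(ℝ, E) 𝓘(ℝ, ℝ) ∞ H) {x₀ : M} {y : E}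
    (hy : y ∈ (extChartAt 𝓘(ℝ, E) x₀).target) :
    Ω.hamVF H ((extChartAt 𝓘(ℝ, E) x₀).symm y) =
      mfderiv 𝓘(ℝ, E) 𝓘(ℝ, E) (extChartAt 𝓘(ℝ, E) x₀).symm y (Ω.hamVFInChart H x₀ y) := by
  symm
  apply Ω.eq_hamVF
  intro w
  have hx := (extChartAt 𝓘(ℝ, E) x₀).map_target hy
  have h2 := mfderiv_extChartAt_symm_mfderiv hx w
  rw [(extChartAt 𝓘(ℝ, E) x₀).right_inv hy] at h2
  have key (z : E) : formInChart Ω.form x₀ y ![Ω.hamVFInChart H x₀ y, z] =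
      fderiv ℝ (H ∘ (extChartAt 𝓘(ℝ, E) x₀).symm) y z := by
    rw [← flatCLM_apply, SymplecticForm.hamVFInChart]
    obtain ⟨e, he⟩ := Ω.isInvertible_flatCLM_formInChart hy
    rw [← he, ContinuousLinearMap.inverse_equiv]
    simp only [ContinuousLinearEquiv.coe_coe, ContinuousLinearEquiv.apply_symm_apply]
  refine (formInChart_apply_mfderiv Ω.form hy (Ω.hamVFInChart H x₀ y) w).symm.trans
    ((key _).trans ?_)
  have h4 : MDifferentiableAt 𝓘(ℝ, E) 𝓘(ℝ, E) (extChartAt 𝓘(ℝ, E) x₀).symm y :=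
    (contMDiffOn_extChartAt_symm (n := ∞) x₀).contMDiffAt
      ((isOpen_extChartAt_target x₀).mem_nhds hy) |>.mdifferentiableAt (by simp)
  have h5 := mfderiv_comp (I'' := 𝓘(ℝ, ℝ)) y (hH.mdifferentiableAt (by simp)) h4
  rw [mfderiv_eq_fderiv] at h5
  rw [h5]
  exact congrArg (fun z : E => (mfderiv 𝓘(ℝ, E) 𝓘(ℝ, ℝ) H _ : E →L[ℝ] ℝ) z) h2

/-- A Hamiltonian vector field is `C¹`. -/
theorem SymplecticForm.contMDiff_hamVF (Ω : SymplecticForm E M) {H : M → ℝ}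
    (hH : ContMDiff 𝓘(ℝ, E) 𝓘(ℝ, ℝ) ∞ H) :
    CMDiff 1 (fun x ↦ (⟨x, Ω.hamVF H x⟩ : TangentBundle 𝓘(ℝ, E) M)) := by
  have : CompleteSpace E := FiniteDimensional.complete ℝ E
  have : IsManifold 𝓘(ℝ, E) 1 M := .of_le (n := ∞) (by simp)
  intro x₀
  set φ := extChartAt 𝓘(ℝ, E) x₀ with hφ
  have h1 : ContMDiffAt 𝓘(ℝ, E) 𝓘(ℝ, E).tangent 1
      (fun x ↦ (⟨x, VectorField.mpullback 𝓘(ℝ, E) 𝓘(ℝ, E) φ (Ω.hamVFInChart H x₀) x⟩ :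
        TangentBundle 𝓘(ℝ, E) M)) x₀ := by
    refine ContMDiffAt.mpullback_vectorField_preimage (n := ∞) ?_ contMDiffAt_extChartAt
      (isInvertible_mfderiv_extChartAt (mem_extChartAt_source x₀)) (by norm_cast)
    exact contMDiffAt_vectorSpace_iff_contDiffAt.2
      (Ω.contDiffAt_hamVFInChart hH (mem_extChartAt_target x₀))
  refine h1.congr_of_eventuallyEq ?_
  filter_upwards [extChartAt_source_mem_nhds (I := 𝓘(ℝ, E)) x₀] with x hx
  congr 1
  obtain ⟨e, he⟩ := isInvertible_mfderiv_extChartAt (I := 𝓘(ℝ, E)) hx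
  have h2 := Ω.hamVF_eq_hamVFInChart hH (φ.map_source hx)
  rw [φ.left_inv hx] at h2
  refine h2.trans ?_
  have h3 := mfderiv_extChartAt_symm_mfderiv hx (e.symm (Ω.hamVFInChart H x₀ (φ x)))
  have h4 : (mfderiv 𝓘(ℝ, E) 𝓘(ℝ, E) φ x : E →L[ℝ] E)
      (e.symm (Ω.hamVFInChart H x₀ (φ x))) = Ω.hamVFInChart H x₀ (φ x) :=
    (congrArg (fun f : E →L[ℝ] E => f (e.symm (Ω.hamVFInChart H x₀ (φ x)))) he.symm).trans
      (e.apply_symm_apply _)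
  have h5 : VectorField.mpullback 𝓘(ℝ, E) 𝓘(ℝ, E) φ (Ω.hamVFInChart H x₀) x =
      e.symm (Ω.hamVFInChart H x₀ (φ x)) := by
    refine (congrArg (fun f : E →L[ℝ] E => f.inverse (Ω.hamVFInChart H x₀ (φ x))) he.symm).trans ?_
    exact congrArg (fun f : E →L[ℝ] E => f _) (ContinuousLinearMap.inverse_equiv e)
  rw [h5]
  exact (congrArg _ h4.symm).trans h3

end HamiltonianVectorField

/-! ### Conserved quantities and symmetry -/

theorem EuclSym.exp_zero : EuclSym.exp 0 = 1 := by
  refine EuclSym.ext' ?_ ?_ ?_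
  · exact Circle.exp_zero
  · change ∫ s in (0 : ℝ)..1, rotZ (Circle.exp (s * 0)) 0 = 0
    simp [rotZ_one]
  · exact Circle.exp_zero

/-- The subgroup `𝒦` leaves the momentum map `J^𝒦` invariant, since it is abelian. -/
theorem IsCoadjointEquivariant.JK_smul {M : Type*} [MulAction EuclSym M]
    {J : M → LieDual} (hJ : IsCoadjointEquivariant J)
    {k : EuclSym} (hk : k ∈ EuclSym.abel) (x : M) : JK J (k • x) = JK J x := by
  have hk' : k.rotL = 1 := hk
  have key (a : E3) (θ : ℝ) : J (k • x) (0, a, θ) = J x (0, a, θ) := by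
    rw [← hJ k x (0, a, θ)]
    simp [Ad, hk', rotZ_one]
  simp only [JK, key]

section Symmetry

open Set

variable {E : Type*} [NormedAddCommGroup E] [NormedSpace ℝ E]
  {M : Type*} [TopologicalSpace M] [ChartedSpace E M]

/-- A function whose derivative along a vector field vanishes is constant along the integral
curves of the vector field. -/
theorem IsMIntegralCurveOn.eq_of_mfderiv_eq_zero {v : (x : M) → TangentSpace 𝓘(ℝ, E) x}
    {γ : ℝ → M} {ε : ℝ} (hγ : IsMIntegralCurveOn γ v (Ioo (-ε) ε)) {F : M → ℝ}
    (hF : MDifferentiable 𝓘(ℝ, E) 𝓘(ℝ, ℝ) F)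
    (h : ∀ x, mfderiv 𝓘(ℝ, E) 𝓘(ℝ, ℝ) F x (v x) = 0) {t : ℝ} (ht : t ∈ Ioo (-ε) ε) :
    F (γ t) = F (γ 0) := by
  have hd : ∀ s ∈ Ioo (-ε) ε, HasFDerivAt (F ∘ γ) (0 : ℝ →L[ℝ] ℝ) s := by
    intro s hs
    have h1 := (hγ s hs).hasMFDerivAt (Ioo_mem_nhds hs.1 hs.2)
    have h2 := ((hF (γ s)).hasMFDerivAt.comp s h1).hasFDerivAt
    refine h2.congr_fderiv ?_
    ext
    refine (congrArg (mfderiv 𝓘(ℝ, E) 𝓘(ℝ, ℝ) F (γ s) : E →L[ℝ] ℝ) (one_smul ℝ _)).trans ?_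
    exact h (γ s)
  have h0 : (0 : ℝ) ∈ Ioo (-ε) ε := ⟨by linarith [ht.1, ht.2], by linarith [ht.1, ht.2]⟩
  refine (convex_Ioo (-ε) ε).is_const_of_fderivWithin_eq_zero (𝕜 := ℝ) (f := F ∘ γ)
    (fun s hs => (hd s hs).differentiableAt.differentiableWithinAt) (fun s hs => ?_) ht h0
  rw [fderivWithin_of_isOpen isOpen_Ioo hs, (hd s hs).fderiv]

variable [MulAction EuclSym M]

/-- An invariant Hamiltonian does not change along the infinitesimal generators. -/
theorem mfderiv_infGen_eq_zero {H : M → ℝ} (hH : ContMDiff 𝓘(ℝ, E) 𝓘(ℝ, ℝ) ∞ H)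
    (hHinv : ∀ (g : EuclSym) (x : M), H (g • x) = H x) (ξ : LieAlg) (x : M) :
    mfderiv 𝓘(ℝ, E) 𝓘(ℝ, ℝ) H x (infGen E ξ x) = 0 := by
  by_cases hd : MDifferentiableAt 𝓘(ℝ, ℝ) 𝓘(ℝ, E) (fun t : ℝ => EuclSym.exp (t • ξ) • x) 0
  · have hc : EuclSym.exp ((0 : ℝ) • ξ) • x = x := by rw [zero_smul, EuclSym.exp_zero, one_smul]
    have h := mfderiv_comp (0 : ℝ) (hH.mdifferentiableAt (by simp)) hd
    have e : H ∘ (fun t : ℝ => EuclSym.exp (t • ξ) • x) = fun _ => H x :=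
      funext fun t => hHinv _ x
    rw [e, mfderiv_const] at h
    have h1 : (mfderiv 𝓘(ℝ, E) 𝓘(ℝ, ℝ) H (EuclSym.exp ((0 : ℝ) • ξ) • x) : E →L[ℝ] ℝ) =
        mfderiv 𝓘(ℝ, E) 𝓘(ℝ, ℝ) H x := by rw [hc]
    refine (congrArg (fun f : E →L[ℝ] ℝ => f (infGen E ξ x)) h1).symm.trans ?_
    exact (congrArg (fun f : ℝ →L[ℝ] ℝ => f 1) h).symm
  -- where the orbit curve is not differentiable, `infGen` has the junk value `0`
  · have h : infGen E ξ x = 0 :=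
      congrArg (fun f : ℝ →L[ℝ] E => f 1) (mfderiv_zero_of_not_mdifferentiableAt hd)
    rw [h, map_zero]

/-- **Noether's theorem**: the momentum map is infinitesimally conserved. -/
theorem IsMomentumMap.mfderiv_hamVF_eq_zero [FiniteDimensional ℝ E] {Ω : SymplecticForm E M}
    {H : M → ℝ}
    (hH : ContMDiff 𝓘(ℝ, E) 𝓘(ℝ, ℝ) ∞ H) (hHinv : ∀ (g : EuclSym) (x : M), H (g • x) = H x)
    {J : M → LieDual} (hmom : IsMomentumMap Ω J) (ξ : LieAlg) (x : M) :
    mfderiv 𝓘(ℝ, E) 𝓘(ℝ, ℝ) (fun y => J y ξ) x (Ω.hamVF H x) = 0 := by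
  refine (hmom ξ x _).symm.trans (neg_eq_zero.mp ?_)
  have h := (Ω.form x).toAlternatingMap.map_swap ![infGen E ξ x, Ω.hamVF H x]
    (i := 0) (j := 1) (by simp)
  have e : ![infGen E ξ x, Ω.hamVF H x] ∘ Equiv.swap (0 : Fin 2) 1 =
      ![Ω.hamVF H x, infGen E ξ x] := by
    ext i; fin_cases i <;> simp
  rw [e] at h
  exact h.symm.trans ((Ω.form_hamVF H x _).trans (mfderiv_infGen_eq_zero hH hHinv ξ x))

variable [ContMDiffSMul EuclSym.model 𝓘(ℝ, E) ∞ EuclSym M]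

theorem mfderiv_smul_mfderiv_inv_smul (g : EuclSym) (x : M) (w : E) :
    (mfderiv 𝓘(ℝ, E) 𝓘(ℝ, E) (fun y : M => g • y) x : E →L[ℝ] E)
      ((mfderiv 𝓘(ℝ, E) 𝓘(ℝ, E) (fun y : M => g⁻¹ • y) (g • x) : E →L[ℝ] E) w) = w := by
  have hd (k : EuclSym) (z : M) := (ContMDiffSMul.contMDiff_const_smul (I := EuclSym.model)
    (I' := 𝓘(ℝ, E)) (M := M) (n := ∞) k).mdifferentiableAt (x := z) (by simp)
  have h := mfderiv_comp (g • x) (hd g (g⁻¹ • g • x)) (hd g⁻¹ (g • x))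
  have e : (fun y : M => g • y) ∘ (fun y : M => g⁻¹ • y) = id := by
    ext y; simp
  rw [e, mfderiv_id] at h
  have e2 : (mfderiv 𝓘(ℝ, E) 𝓘(ℝ, E) (fun y : M => g • y) (g⁻¹ • g • x) : E →L[ℝ] E) =
      mfderiv 𝓘(ℝ, E) 𝓘(ℝ, E) (fun y : M => g • y) x := by
    rw [inv_smul_smul]
  have h' := congrArg (fun f : E →L[ℝ] E => f w) h
  rw [← e2]
  exact h'.symm

variable [FiniteDimensional ℝ E]

/-- The Hamiltonian vector field of an invariant function is equivariant. -/
theorem SymplecticForm.hamVF_smul {Ω : SymplecticForm E M} (hΩ : IsSymplecticAction Ω)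
    {H : M → ℝ} (hH : ContMDiff 𝓘(ℝ, E) 𝓘(ℝ, ℝ) ∞ H)
    (hHinv : ∀ (g : EuclSym) (x : M), H (g • x) = H x) (g : EuclSym) (x : M) :
    Ω.hamVF H (g • x) = mfderiv 𝓘(ℝ, E) 𝓘(ℝ, E) (fun y : M => g • y) x (Ω.hamVF H x) := by
  symm
  apply Ω.eq_hamVF
  intro w
  let D : E →L[ℝ] E := mfderiv 𝓘(ℝ, E) 𝓘(ℝ, E) (fun y : M => g • y) x
  let u : E := (mfderiv 𝓘(ℝ, E) 𝓘(ℝ, E) (fun y : M => g⁻¹ • y) (g • x) : E →L[ℝ] E) w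
  have hu : D u = w := mfderiv_smul_mfderiv_inv_smul (E := E) g x (w : E)
  have h := mfderiv_comp x (hH.mdifferentiableAt (x := g • x) (by simp))
    ((ContMDiffSMul.contMDiff_const_smul (I := EuclSym.model) (I' := 𝓘(ℝ, E)) (M := M) (n := ∞)
      g).mdifferentiableAt (x := x) (by simp))
  have e : H ∘ (fun y : M => g • y) = H := funext fun y => hHinv g y
  rw [e] at h
  let B : E [⋀^Fin 2]→L[ℝ] ℝ := Ω.form (g • x)
  let DH (z : M) : E →L[ℝ] ℝ := mfderiv 𝓘(ℝ, E) 𝓘(ℝ, ℝ) H z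
  change B ![D (Ω.hamVF H x), w] = DH (g • x) w
  calc B ![D (Ω.hamVF H x), w] = B ![D (Ω.hamVF H x), D u] := by rw [hu]
    _ = (Ω.form x : E [⋀^Fin 2]→L[ℝ] ℝ) ![(Ω.hamVF H x : E), u] := hΩ g x _ _
    _ = DH x u := Ω.form_hamVF H x u
    _ = DH (g • x) (D u) := congrArg (fun f : E →L[ℝ] ℝ => f u) h
    _ = DH (g • x) w := by rw [hu]

/-- The group maps solutions to solutions. -/
theorem IsMIntegralCurveOn.smul_hamVF {Ω : SymplecticForm E M} (hΩ : IsSymplecticAction Ω)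
    {H : M → ℝ} (hH : ContMDiff 𝓘(ℝ, E) 𝓘(ℝ, ℝ) ∞ H)
    (hHinv : ∀ (g : EuclSym) (x : M), H (g • x) = H x) {γ : ℝ → M} {s : Set ℝ}
    (hγ : IsMIntegralCurveOn γ (Ω.hamVF H) s) (g : EuclSym) :
    IsMIntegralCurveOn (fun t => g • γ t) (Ω.hamVF H) s := by
  intro t ht
  have h := ((ContMDiffSMul.contMDiff_const_smul (I := EuclSym.model) (I' := 𝓘(ℝ, E)) (M := M)
    (n := ∞) g).mdifferentiableAt (x := γ t)
    (by simp)).hasMFDerivAt.comp_hasMFDerivWithinAt t (hγ t ht)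
  refine HasMFDerivWithinAt.congr_mfderiv h (ContinuousLinearMap.ext_ring ?_)
  have h1 := Ω.hamVF_smul hΩ hH hHinv g (γ t)
  refine Eq.trans ?_ (h1.symm.trans (one_smul ℝ (Ω.hamVF H (g • γ t) : E)).symm)
  exact congrArg (mfderiv 𝓘(ℝ, E) 𝓘(ℝ, E) (fun y : M => g • y) (γ t) : E →L[ℝ] E)
    (one_smul ℝ (Ω.hamVF H (γ t) : E))

end Symmetry

/-! ### The inverse function theorem and adapted frames -/

section InverseFunction

open Set

variable {X Y : Type*} [NormedAddCommGroup X] [NormedSpace ℝ X] [CompleteSpace X]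
  [NormedAddCommGroup Y] [NormedSpace ℝ Y]

/-- **Inverse function theorem** in the smooth category: near a point with invertible derivative,
a smooth function is a smooth partial homeomorphism with smooth inverse. The domain can be chosen
inside any neighbourhood, given as a property `P` that holds near the point. -/
theorem exists_partialDiffeomorph_of_hasFDerivAt {f : X → Y} {a : X} {e : X ≃L[ℝ] Y} {P : X → Prop}
    (hf : ∀ᶠ x in 𝓝 a, ContDiffAt ℝ ∞ f x) (he : HasFDerivAt f (e : X →L[ℝ] Y) a)
    (hP : ∀ᶠ x in 𝓝 a, P x) :
    ∃ Ψ : PartialDiffeomorph 𝓘(ℝ, X) 𝓘(ℝ, Y) X Y ∞, a ∈ Ψ.source ∧ (∀ x, Ψ x = f x) ∧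
      ∀ x ∈ Ψ.source, P x := by
  have hfa : ContDiffAt ℝ ∞ f a := hf.self_of_nhds
  have hcont : ContinuousAt (fderiv ℝ f) a :=
    (hfa.fderiv_right (m := 0) (by norm_cast)).continuousAt
  -- invertibility of the derivative is an open condition
  have hinv : ∀ᶠ x in 𝓝 a, ∃ e' : X ≃L[ℝ] Y, (e' : X →L[ℝ] Y) = fderiv ℝ f x := by
    have h := ContinuousLinearEquiv.nhds e
    rw [← he.fderiv] at h
    exact hcont.eventually h
  obtain ⟨V, hV, hVo, haV⟩ := eventually_nhds_iff.mp (hf.and (hinv.and hP))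
  let Ψ₀ := (hfa.toOpenPartialHomeomorph f he (by simp)).restrOpen V hVo
  have hs : Ψ₀.source ⊆ V := fun x hx => hx.2
  refine ⟨{ Ψ₀ with
    contMDiffOn_toFun := ?_
    contMDiffOn_invFun := ?_ }, ⟨?_, haV⟩, fun x => rfl, fun x hx => (hV x (hs hx)).2.2⟩
  · intro x hx
    exact (hV x (hs hx)).1.contMDiffAt.contMDiffWithinAt
  · intro y hy
    have hx := Ψ₀.map_target hy
    obtain ⟨e', he'⟩ := (hV _ (hs hx)).2.1
    have hd := (hV _ (hs hx)).1
    refine (Ψ₀.contDiffAt_symm hy (f₀' := e') ?_ hd).contMDiffAt.contMDiffWithinAt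
    rw [he']
    exact (hd.differentiableAt (by simp)).hasFDerivAt
  · exact hfa.mem_toOpenPartialHomeomorph_source he (by simp)

end InverseFunction

section LinearAlgebra

/-- If `A` is injective with range in the kernel of the surjective map `L`, then `A` and a right
inverse of `L` can be completed to a frame adapted to the flag `range A ≤ ker L`. -/
theorem exists_adapted_frame {P K W E : Type*} [AddCommGroup P] [Module ℝ P]
    [AddCommGroup K] [Module ℝ K] [AddCommGroup W] [Module ℝ W] [AddCommGroup E] [Module ℝ E]
    [FiniteDimensional ℝ P] [FiniteDimensional ℝ K] [FiniteDimensional ℝ W] [FiniteDimensional ℝ E]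
    (A : P →ₗ[ℝ] E) (L : E →ₗ[ℝ] K) (hA : Function.Injective A) (hL : Function.Surjective L)
    (hLA : ∀ p, L (A p) = 0)
    (hW : Module.finrank ℝ W = Module.finrank ℝ E - (Module.finrank ℝ P + Module.finrank ℝ K)) :
    ∃ (B : K →ₗ[ℝ] E) (C : W →ₗ[ℝ] E), (∀ ν, L (B ν) = ν) ∧ (∀ w, L (C w) = 0) ∧
      Function.Bijective (fun x : P × K × W => A x.1 + (B x.2.1 + C x.2.2)) := by
  obtain ⟨B, hB⟩ := L.exists_rightInverse_of_surjective (LinearMap.range_eq_top.2 hL)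
  have hB' (ν) : L (B ν) = ν := LinearMap.congr_fun hB ν
  let A' : P →ₗ[ℝ] LinearMap.ker L := A.codRestrict _ hLA
  have hA' : Function.Injective A' := fun p q h => hA (congrArg Subtype.val h)
  obtain ⟨Q, hQ⟩ := Submodule.exists_isCompl (LinearMap.range A')
  have d1 := LinearMap.finrank_range_of_inj hA'
  have d2 := Submodule.finrank_add_eq_of_isCompl hQ
  have d3 := L.finrank_range_add_finrank_ker
  rw [LinearMap.range_eq_top.2 hL, finrank_top] at d3
  let e : W ≃ₗ[ℝ] Q := LinearEquiv.ofFinrankEq _ _ (by omega)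
  let C : W →ₗ[ℝ] E := (LinearMap.ker L).subtype ∘ₗ Q.subtype ∘ₗ e.toLinearMap
  have hC (w) : L (C w) = 0 := (e w : LinearMap.ker L).2
  let T : (P × K × W) →ₗ[ℝ] E := A.coprod (B.coprod C)
  have hT : Function.Injective T := by
    rw [← LinearMap.ker_eq_bot, LinearMap.ker_eq_bot']
    rintro ⟨p, ν, w⟩ h
    have h' : A p + (B ν + C w) = 0 := h
    have hν : ν = 0 := by simpa [hLA, hB', hC] using congrArg L h'
    subst hν
    have h2 : A' p = -(e w : LinearMap.ker L) := by
      apply Subtype.ext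
      rw [map_zero, zero_add] at h'
      exact eq_neg_of_add_eq_zero_left h'
    have h3 : A' p = 0 := by
      have := hQ.disjoint
      rw [Submodule.disjoint_def] at this
      exact this _ ⟨p, rfl⟩ (h2 ▸ Q.neg_mem (e w).2)
    have hp : p = 0 := hA' (h3.trans (map_zero A').symm)
    have hw : w = 0 := by
      rw [h3, eq_comm, neg_eq_zero] at h2
      exact e.injective ((Subtype.ext h2 : e w = 0).trans (map_zero e).symm)
    rw [hp, hw]; rfl
  refine ⟨B, C, hB', hC, hT, (LinearMap.injective_iff_surjective_of_finrank_eq_finrank ?_).1 hT⟩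
  simp only [Module.finrank_prod]
  omega

end LinearAlgebra

/-! ### The subgroup `𝒦` -/

section Orbit

open Set

/-- The element `(0, a, θ)` of `𝒦`, as a function of its coordinates. -/
noncomputable def EuclSym.ofAbel (p : E3 × ℝ) : EuclSym := EuclSym.mk 1 p.1 (Circle.exp p.2)

namespace EuclSym

theorem ofAbel_mem (p : E3 × ℝ) : ofAbel p ∈ EuclSym.abel := rfl

theorem ofAbel_zero : ofAbel 0 = 1 :=
  EuclSym.ext' rfl rfl Circle.exp_zero

theorem ofAbel_add (p q : E3 × ℝ) : ofAbel (p + q) = ofAbel p * ofAbel q := by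
  refine EuclSym.ext' (mul_one 1).symm ?_ (Circle.exp_add _ _)
  exact congrArg (p.1 + ·) (rotZ_one q.1).symm

theorem exp_eq_ofAbel (p : E3 × ℝ) (t : ℝ) : EuclSym.exp (t • (0, p.1, p.2)) = ofAbel (t • p) := by
  refine EuclSym.ext' ?_ ?_ rfl
  · change Circle.exp (t • 0) = 1
    simp
  · change ∫ s in (0 : ℝ)..1, rotZ (Circle.exp (s * (t • 0))) (t • p.1) = t • p.1
    simp [rotZ_one]

theorem contMDiff_ofAbel : ContMDiff 𝓘(ℝ, E3 × ℝ) EuclSym.model ∞ EuclSym.ofAbel := by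
  have h1 : ContMDiff 𝓘(ℝ, E3 × ℝ) 𝓘(ℝ, E3) ∞ (fun p : E3 × ℝ => p.1) := contDiff_fst.contMDiff
  have h2 : ContMDiff 𝓘(ℝ, E3 × ℝ) (𝓡 1) ∞ (fun p : E3 × ℝ => Circle.exp p.2) :=
    contMDiff_circleExp.comp contDiff_snd.contMDiff
  exact (contMDiff_const (c := (1 : Circle))).prodMk (h1.prodMk h2)

theorem eq_zero_of_forall_ofAbel_mem_diag {p : E3 × ℝ} (h : ∀ t : ℝ, ofAbel (t • p) ∈ diag) :
    p = 0 := by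
  have h1 : p.1 = 0 := by simpa [ofAbel, trans, mk] using (h 1).1
  have h2 (t : ℝ) : Circle.exp (t * p.2) = 1 := (h t).2.symm
  have h3 : p.2 = 0 := by
    by_contra hne
    have h4 := h2 (Real.pi / p.2)
    rw [div_mul_cancel₀ _ hne] at h4
    have h5 := congrArg (fun z : Circle => (z : ℂ)) h4
    simp only [Circle.coe_exp, Complex.exp_pi_mul_I, Circle.coe_one] at h5
    norm_num at h5
  exact Prod.ext h1 h3

end EuclSym

end Orbit

/-! ### Components of the momentum map -/

section MomentumComponents

theorem momentum_component_eq {M : Type*} (J : M → LieDual) (x : M) (p : E3 × ℝ) :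
    J x (0, p.1, p.2) = p.1 0 * (JK J x).1 0 + p.1 1 * (JK J x).1 1 + p.1 2 * (JK J x).1 2 +
      p.2 * (JK J x).2 := by
  have h : ((0, p.1, p.2) : LieAlg) =
      p.1 0 • ((0, EuclideanSpace.single 0 1, 0) : LieAlg) +
      p.1 1 • ((0, EuclideanSpace.single 1 1, 0) : LieAlg) +
      p.1 2 • ((0, EuclideanSpace.single 2 1, 0) : LieAlg) + p.2 • ((0, 0, 1) : LieAlg) := by
    ext i
    · simp
    · fin_cases i <;> simp
    · simp
  rw [h]
  simp only [map_add, map_smul, smul_eq_mul]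
  rfl

/-- A linear functional of the values of `J^𝒦` is a component of the momentum map `J`. -/
theorem exists_momentum_component_of_functional (f : KDual →ₗ[ℝ] ℝ) :
    ∃ p : E3 × ℝ, (p = 0 → f = 0) ∧
      ∀ {M : Type*} (J : M → LieDual) (x : M), f (JK J x) = J x (0, p.1, p.2) := by
  have key (a : E3) (s : ℝ) : f (a, s) = a 0 * f (EuclideanSpace.single 0 1, 0) +
      a 1 * f (EuclideanSpace.single 1 1, 0) + a 2 * f (EuclideanSpace.single 2 1, 0) +
      s * f (0, 1) := by
    have h : ((a, s) : KDual) = a 0 • (EuclideanSpace.single 0 1, 0) +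
        a 1 • (EuclideanSpace.single 1 1, 0) + a 2 • (EuclideanSpace.single 2 1, 0) +
        s • (0, 1) := by
      ext i
      · fin_cases i <;> simp
      · simp
    rw [h]
    simp only [map_add, map_smul, smul_eq_mul]
  refine ⟨(!₂[f (EuclideanSpace.single 0 1, 0), f (EuclideanSpace.single 1 1, 0),
    f (EuclideanSpace.single 2 1, 0)], f (0, 1)), fun h => ?_, fun J x => ?_⟩
  · have h1 := congrArg Prod.fst h
    have h2 : f (0, 1) = 0 := congrArg Prod.snd h
    have e0 : f (EuclideanSpace.single 0 1, 0) = 0 := congrArg (fun a : E3 => a 0) h1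
    have e1 : f (EuclideanSpace.single 1 1, 0) = 0 := congrArg (fun a : E3 => a 1) h1
    have e2 : f (EuclideanSpace.single 2 1, 0) = 0 := congrArg (fun a : E3 => a 2) h1
    refine LinearMap.ext fun q => ?_
    rw [← Prod.mk.eta (p := q), key, e0, e1, e2, h2]
    simp
  · rw [momentum_component_eq J x, ← Prod.mk.eta (p := JK J x), key]
    simp only [Matrix.cons_val_zero, Matrix.cons_val_one, Matrix.cons_val]
    ring

variable {E : Type*} [NormedAddCommGroup E] [NormedSpace ℝ E]
  {M : Type*} [TopologicalSpace M] [ChartedSpace E M]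

theorem contMDiff_momentum_component {J : M → LieDual}
    (hJ : ContMDiff 𝓘(ℝ, E) 𝓘(ℝ, LieDual) ∞ J) (ξ : LieAlg) :
    ContMDiff 𝓘(ℝ, E) 𝓘(ℝ, ℝ) ∞ (fun x => J x ξ) :=
  (ContinuousLinearMap.apply ℝ ℝ ξ).contDiff.contMDiff.comp hJ

theorem contMDiff_JK {J : M → LieDual} (hJ : ContMDiff 𝓘(ℝ, E) 𝓘(ℝ, LieDual) ∞ J) :
    ContMDiff 𝓘(ℝ, E) 𝓘(ℝ, KDual) ∞ (JK J) := by
  have h : ContDiff ℝ ∞ (fun μ : LieDual =>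
      ((!₂[μ (0, EuclideanSpace.single 0 1, 0), μ (0, EuclideanSpace.single 1 1, 0),
        μ (0, EuclideanSpace.single 2 1, 0)], μ (0, 0, 1)) : KDual)) := by
    refine ContDiff.prodMk (contDiff_euclidean.2 fun i => ?_)
      (ContinuousLinearMap.apply ℝ ℝ ((0, 0, 1) : LieAlg)).contDiff
    fin_cases i <;> exact (ContinuousLinearMap.apply ℝ ℝ (_ : LieAlg)).contDiff
  exact h.contMDiff.comp hJ

end MomentumComponents

/-! ### The orbit map of `𝒦` -/

theorem ofAbel_zero_smul {M : Type*} [MulAction EuclSym M] (x : M) : EuclSym.ofAbel 0 • x = x := by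
  rw [EuclSym.ofAbel_zero, one_smul]

section Orbit

open Set

variable {E : Type*} [NormedAddCommGroup E] [NormedSpace ℝ E]
  {M : Type*} [TopologicalSpace M] [ChartedSpace E M]

theorem mfderiv_eq_zero_of_fderiv_comp_extChartAt_symm [IsManifold 𝓘(ℝ, E) ∞ M] {F : M → ℝ}
    (hF : ContMDiff 𝓘(ℝ, E) 𝓘(ℝ, ℝ) ∞ F) (x : M)
    (h : fderiv ℝ (F ∘ (extChartAt 𝓘(ℝ, E) x).symm) (extChartAt 𝓘(ℝ, E) x x) = 0)
    (w : TangentSpace 𝓘(ℝ, E) x) : mfderiv 𝓘(ℝ, E) 𝓘(ℝ, ℝ) F x w = 0 := by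
  have h1 : MDifferentiableAt 𝓘(ℝ, E) 𝓘(ℝ, ℝ) (F ∘ (extChartAt 𝓘(ℝ, E) x).symm)
      (extChartAt 𝓘(ℝ, E) x x) :=
    (((contDiffOn_comp_extChartAt_symm hF x).contDiffAt
      (extChartAt_target_mem_nhds x)).differentiableAt (by simp)).mdifferentiableAt
  have h2 := h1.hasMFDerivAt.comp x (mdifferentiableAt_extChartAt (I := 𝓘(ℝ, E))
    (mem_chart_source E x)).hasMFDerivAt
  rw [mfderiv_eq_fderiv, h] at h2
  have h3 := h2.congr_of_eventuallyEq (f₁ := F) (by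
    filter_upwards [extChartAt_source_mem_nhds (I := 𝓘(ℝ, E)) x] with y hy
    exact congrArg F ((extChartAt 𝓘(ℝ, E) x).left_inv hy).symm)
  rw [h3.mfderiv]
  rfl

variable [MulAction EuclSym M] [ContMDiffSMul EuclSym.model 𝓘(ℝ, E) ∞ EuclSym M]

theorem contMDiff_ofAbel_smul : ContMDiff (𝓘(ℝ, E3 × ℝ).prod 𝓘(ℝ, E)) 𝓘(ℝ, E) ∞
    (fun q : (E3 × ℝ) × M => EuclSym.ofAbel q.1 • q.2) :=
  (ContMDiffSMul.contMDiff_smul (I := EuclSym.model) (G := EuclSym)).comp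
    ((EuclSym.contMDiff_ofAbel.comp contMDiff_fst).prodMk contMDiff_snd)

theorem contMDiff_exp_smul (p : E3 × ℝ) (x : M) : ContMDiff 𝓘(ℝ, ℝ) 𝓘(ℝ, E) ∞
    (fun t : ℝ => EuclSym.exp (t • ((0, p.1, p.2) : LieAlg)) • x) := by
  simp only [EuclSym.exp_eq_ofAbel]
  exact (contMDiff_ofAbel_smul (E := E)).comp
    ((contDiff_id.smul contDiff_const).contMDiff.prodMk contMDiff_const)

variable [IsManifold 𝓘(ℝ, E) ∞ M]

/-- If the isotropy group of `x` meets `𝒦` trivially, then no infinitesimal generator of `𝒦`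
vanishes at `x`: otherwise the orbit of a one-parameter group would be constant. -/
theorem IsAxisymmetric.eq_zero_of_infGen_eq_zero [T2Space M] {x : M} (hx : IsAxisymmetric x)
    {p : E3 × ℝ} (h : infGen E (0, p.1, p.2) x = 0) : p = 0 := by
  have : IsManifold 𝓘(ℝ, E) 1 M := .of_le (n := ∞) (by simp)
  set c : ℝ → M := fun t => EuclSym.exp (t • ((0, p.1, p.2) : LieAlg)) • x with hc
  have hd : MDifferentiable 𝓘(ℝ, ℝ) 𝓘(ℝ, E) c := (contMDiff_exp_smul p x).mdifferentiable (by simp)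
  have h0 (r : ℝ) (hr : r = 0) : HasMFDerivAt 𝓘(ℝ, ℝ) 𝓘(ℝ, E) c r (0 : ℝ →L[ℝ] E) := by
    subst hr
    have h1 := (hd 0).hasMFDerivAt
    have h2 : (mfderiv 𝓘(ℝ, ℝ) 𝓘(ℝ, E) c 0 : ℝ →L[ℝ] E) = 0 := ContinuousLinearMap.ext_ring h
    exact h1.congr_mfderiv h2
  have hcurve : IsMIntegralCurve c (fun y => (0 : TangentSpace 𝓘(ℝ, E) y)) := by
    intro t
    have e : c = (fun y : M => EuclSym.ofAbel (t • p) • y) ∘ c ∘ (fun s => s - t) := by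
      ext s
      simp only [hc, Function.comp_apply, EuclSym.exp_eq_ofAbel, smul_smul,
        ← EuclSym.ofAbel_add, ← add_smul]
      simp
    have h1 : HasMFDerivAt 𝓘(ℝ, ℝ) 𝓘(ℝ, ℝ) (fun s : ℝ => s - t) t (ContinuousLinearMap.id ℝ ℝ) :=
      ((hasFDerivAt_id t).sub_const t).hasMFDerivAt
    have h2 : HasMFDerivAt 𝓘(ℝ, ℝ) 𝓘(ℝ, E) c ((fun s : ℝ => s - t) t) (0 : ℝ →L[ℝ] E) :=
      h0 _ (sub_self t)
    have h3 := ((ContMDiffSMul.contMDiff_const_smul (I := EuclSym.model) (I' := 𝓘(ℝ, E)) (M := M)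
      (n := ∞) (EuclSym.ofAbel (t • p))).mdifferentiableAt
      (x := (c ∘ (fun s => s - t)) t) (by simp)).hasMFDerivAt.comp t
        (HasMFDerivAt.comp (f := fun s : ℝ => s - t) t h2 h1)
    rw [← e] at h3
    refine h3.congr_mfderiv (ContinuousLinearMap.ext_ring ?_)
    refine (map_zero (mfderiv 𝓘(ℝ, E) 𝓘(ℝ, E) (fun y : M => EuclSym.ofAbel (t • p) • y)
      ((c ∘ (fun s => s - t)) t) : E →L[ℝ] E)).trans ?_
    exact (smul_zero (1 : ℝ)).symm
  have hconst : IsMIntegralCurve (fun _ : ℝ => x) (fun y => (0 : TangentSpace 𝓘(ℝ, E) y)) := by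
    intro t
    refine (hasMFDerivAt_const x t).congr_mfderiv (ContinuousLinearMap.ext_ring ?_)
    exact (smul_zero (1 : ℝ)).symm
  have heq : c = fun _ => x := by
    refine isMIntegralCurve_Ioo_eq_of_contMDiff_boundaryless (t₀ := 0)
      (Bundle.contMDiff_zeroSection ℝ (TangentSpace 𝓘(ℝ, E) (M := M))) hcurve hconst ?_
    simp only [hc]
    rw [zero_smul, EuclSym.exp_zero, one_smul]
  refine EuclSym.eq_zero_of_forall_ofAbel_mem_diag fun t => ?_
  rw [← hx, MulAction.mem_stabilizer_iff, ← EuclSym.exp_eq_ofAbel]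
  exact congrFun heq t

/-- The derivative of the orbit map of `𝒦`, in the chart at the base point. -/
noncomputable def orbitDeriv (x : M) : (E3 × ℝ) →L[ℝ] E :=
  fderiv ℝ (fun p : E3 × ℝ => extChartAt 𝓘(ℝ, E) x (EuclSym.ofAbel p • x)) 0

/-- The action of `𝒦` in the chart at `x` is smooth near the base point. -/
theorem contDiffAt_action_inChart {x : M} {q : (E3 × ℝ) × E}
    (hq : q.2 ∈ (extChartAt 𝓘(ℝ, E) x).target)
    (hq' : EuclSym.ofAbel q.1 • (extChartAt 𝓘(ℝ, E) x).symm q.2 ∈ (extChartAt 𝓘(ℝ, E) x).source) :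
    ContDiffAt ℝ ∞ (fun q : (E3 × ℝ) × E => extChartAt 𝓘(ℝ, E) x
      (EuclSym.ofAbel q.1 • (extChartAt 𝓘(ℝ, E) x).symm q.2)) q := by
  rw [← contMDiffAt_iff_contDiffAt]
  have h1 : ContMDiffAt 𝓘(ℝ, E) 𝓘(ℝ, E) ∞ (extChartAt 𝓘(ℝ, E) x).symm q.2 :=
    (contMDiffOn_extChartAt_symm x).contMDiffAt ((isOpen_extChartAt_target x).mem_nhds hq)
  have h2 : ContMDiffAt 𝓘(ℝ, (E3 × ℝ) × E) 𝓘(ℝ, E) ∞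
      (fun q : (E3 × ℝ) × E => (extChartAt 𝓘(ℝ, E) x).symm q.2) q :=
    ContMDiffAt.comp q h1 contDiff_snd.contMDiff.contMDiffAt
  have h3 : ContMDiffAt 𝓘(ℝ, (E3 × ℝ) × E) 𝓘(ℝ, E) ∞ (fun q : (E3 × ℝ) × E =>
      EuclSym.ofAbel q.1 • (extChartAt 𝓘(ℝ, E) x).symm q.2) q :=
    ContMDiffAt.comp q (contMDiff_ofAbel_smul (E := E)).contMDiffAt
      (contDiff_fst.contMDiff.contMDiffAt.prodMk h2)
  refine ContMDiffAt.comp q (contMDiffAt_extChartAt' ?_) h3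
  rwa [← extChartAt_source 𝓘(ℝ, E)]

theorem hasFDerivAt_orbitDeriv (x : M) :
    HasFDerivAt (fun p : E3 × ℝ => extChartAt 𝓘(ℝ, E) x (EuclSym.ofAbel p • x))
      (orbitDeriv x : (E3 × ℝ) →L[ℝ] E) 0 := by
  have h := contDiffAt_action_inChart (x := x) (q := ((0 : E3 × ℝ), extChartAt 𝓘(ℝ, E) x x))
    (mem_extChartAt_target x)
    (by rw [extChartAt_to_inv, ofAbel_zero_smul]; exact mem_extChartAt_source x)
  have h2 := h.comp (0 : E3 × ℝ)
    (contDiff_id.prodMk contDiff_const : ContDiff ℝ ∞ fun p : E3 × ℝ =>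
      (p, extChartAt 𝓘(ℝ, E) x x)).contDiffAt
  have h3 := (h2.differentiableAt (by simp)).hasFDerivAt
  simp only [Function.comp_def, extChartAt_to_inv] at h3
  exact h3

theorem IsAxisymmetric.orbitDeriv_injective [T2Space M] {x : M} (hx : IsAxisymmetric x) :
    Function.Injective (orbitDeriv x : (E3 × ℝ) →L[ℝ] E) := by
  have : IsManifold 𝓘(ℝ, E) 1 M := .of_le (n := ∞) (by simp)
  rw [injective_iff_map_eq_zero]
  intro p hp
  refine hx.eq_zero_of_infGen_eq_zero (E := E) ?_
  set φ := extChartAt 𝓘(ℝ, E) x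
  let b : ℝ → E := fun t => φ (EuclSym.ofAbel (t • p) • x)
  have hb : HasFDerivAt b (0 : ℝ →L[ℝ] E) 0 := by
    have h1 : HasFDerivAt (fun t : ℝ => t • p) ((1 : ℝ →L[ℝ] ℝ).smulRight p) 0 :=
      (hasFDerivAt_id (𝕜 := ℝ) (0 : ℝ)).smul_const p
    have h2 := hasFDerivAt_orbitDeriv (E := E) x
    rw [← zero_smul ℝ p] at h2
    refine (h2.comp (0 : ℝ) h1).congr_fderiv (ContinuousLinearMap.ext_ring ?_)
    simp [hp]
  have hb0 : b 0 ∈ φ.target := by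
    simp only [b, zero_smul, ofAbel_zero_smul]
    exact mem_extChartAt_target x
  have hs : MDifferentiableAt 𝓘(ℝ, E) 𝓘(ℝ, E) φ.symm (b 0) :=
    ((contMDiffOn_extChartAt_symm (n := ∞) x).contMDiffAt
      ((isOpen_extChartAt_target x).mem_nhds hb0)).mdifferentiableAt (by simp)
  have h3 := (hs.hasMFDerivAt.comp (0 : ℝ) hb.hasMFDerivAt).congr_of_eventuallyEq
    (f₁ := fun t : ℝ => EuclSym.exp (t • ((0, p.1, p.2) : LieAlg)) • x) (by
      have hcont : ContinuousAt (fun t : ℝ => EuclSym.exp (t • ((0, p.1, p.2) : LieAlg)) • x) 0 :=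
        (contMDiff_exp_smul (E := E) p x).continuous.continuousAt
      have hmem := hcont.preimage_mem_nhds (t := φ.source) (by
        rw [zero_smul, EuclSym.exp_zero, one_smul]
        exact extChartAt_source_mem_nhds x)
      filter_upwards [hmem] with t ht
      rw [Function.comp_apply]
      simp only [b, ← EuclSym.exp_eq_ofAbel]
      exact (φ.left_inv ht).symm)
  refine (congrArg (fun f : ℝ →L[ℝ] E => f 1) h3.mfderiv).trans ?_
  exact map_zero (mfderiv 𝓘(ℝ, E) 𝓘(ℝ, E) φ.symm (b 0) : E →L[ℝ] E)

/-- At a point with locally free action of `𝒦` the momentum map `J^𝒦` is a submersion. -/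
theorem IsAxisymmetric.fderiv_JK_surjective [T2Space M] {x : M} (hx : IsAxisymmetric x)
    {Ω : SymplecticForm E M} {J : M → LieDual} (hJ : ContMDiff 𝓘(ℝ, E) 𝓘(ℝ, LieDual) ∞ J)
    (hmom : IsMomentumMap Ω J) {L : E →L[ℝ] KDual}
    (hL : HasFDerivAt (JK J ∘ (extChartAt 𝓘(ℝ, E) x).symm) L (extChartAt 𝓘(ℝ, E) x x)) :
    Function.Surjective L := by
  by_contra hns
  have hlt : LinearMap.range (L : E →ₗ[ℝ] KDual) < ⊤ :=
    lt_top_iff_ne_top.2 fun h => hns (LinearMap.range_eq_top.1 h)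
  obtain ⟨f, hf, hfL⟩ := Submodule.exists_le_ker_of_lt_top _ hlt
  obtain ⟨p, hp, hfJ⟩ := exists_momentum_component_of_functional f
  refine hf (hp (hx.eq_zero_of_infGen_eq_zero (E := E) ?_))
  refine Ω.nondegenerate x _ fun w => (hmom _ x w).trans ?_
  refine mfderiv_eq_zero_of_fderiv_comp_extChartAt_symm (contMDiff_momentum_component hJ _) x ?_ w
  have h1 : (fun y => J y (0, p.1, p.2)) ∘ (extChartAt 𝓘(ℝ, E) x).symm =
      f.toContinuousLinearMap ∘ (JK J ∘ (extChartAt 𝓘(ℝ, E) x).symm) := by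
    ext y
    exact (hfJ J _).symm
  rw [h1, (f.toContinuousLinearMap.hasFDerivAt.comp _ hL).fderiv]
  ext v
  exact hfL ⟨v, rfl⟩

end Orbit

/-! ### Existence of reduction coordinates -/

section Slice

open Set

variable {E : Type*} [NormedAddCommGroup E] [NormedSpace ℝ E]
  {M : Type*} [TopologicalSpace M] [ChartedSpace E M]

/-- The inverse of a chart, as a partial diffeomorphism. -/
noncomputable def chartSymmDiffeo [IsManifold 𝓘(ℝ, E) ∞ M] (x : M) :
    PartialDiffeomorph 𝓘(ℝ, E) 𝓘(ℝ, E) E M ∞ where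
  toPartialEquiv := (extChartAt 𝓘(ℝ, E) x).symm
  open_source := isOpen_extChartAt_target x
  open_target := isOpen_extChartAt_source x
  contMDiffOn_toFun := contMDiffOn_extChartAt_symm x
  contMDiffOn_invFun := by
    rw [PartialEquiv.symm_target, extChartAt_source]
    exact contMDiffOn_extChartAt

/-- A smooth map between normed spaces that fixes a value and has the identity as derivative has
a local inverse with these properties. -/
theorem exists_local_inverse_of_hasFDerivAt_id {X : Type*} [NormedAddCommGroup X] [NormedSpace ℝ X]
    [CompleteSpace X] {g : X → X} {a : X} {P : X → Prop} (hg : ∀ᶠ x in 𝓝 a, ContDiffAt ℝ ∞ g x)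
    (hid : HasFDerivAt g (ContinuousLinearMap.id ℝ X) a) (hga : g a = a) (hP : ∀ᶠ x in 𝓝 a, P x) :
    ∃ h : X → X, h a = a ∧ HasFDerivAt h (ContinuousLinearMap.id ℝ X) a ∧
      ∀ᶠ x in 𝓝 a, ContDiffAt ℝ ∞ h x ∧ g (h x) = x ∧ P (h x) := by
  obtain ⟨Ψ, haΨ, hΨ, hΨP⟩ := exists_partialDiffeomorph_of_hasFDerivAt
    (e := ContinuousLinearEquiv.refl ℝ X) hg hid hP
  have haT : a ∈ Ψ.target := by
    have := Ψ.map_source haΨ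
    rwa [hΨ, hga] at this
  have hha : Ψ.invFun a = a := by
    have := Ψ.left_inv haΨ
    rwa [hΨ, hga] at this
  refine ⟨Ψ.invFun, hha, ?_, ?_⟩
  · refine Ψ.toOpenPartialHomeomorph.hasFDerivAt_symm haT (f' := ContinuousLinearEquiv.refl ℝ X) ?_
    change HasFDerivAt Ψ _ (Ψ.invFun a)
    rw [hha, show (Ψ : X → X) = g from funext hΨ]
    exact hid
  · filter_upwards [Ψ.open_target.mem_nhds haT] with x hx
    refine ⟨?_, (hΨ _).symm.trans (Ψ.right_inv hx), hΨP _ (Ψ.map_target hx)⟩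
    exact (Ψ.contMDiffOn_invFun.contMDiffAt (Ψ.open_target.mem_nhds hx)).contDiffAt

variable [IsManifold 𝓘(ℝ, E) ∞ M]
  [MulAction EuclSym M] [ContMDiffSMul EuclSym.model 𝓘(ℝ, E) ∞ EuclSym M]

/-- The derivative of the `𝒦`-action in the chart at `x`. -/
theorem hasFDerivAt_action_inChart (x : M) :
    HasFDerivAt (fun q : (E3 × ℝ) × E => extChartAt 𝓘(ℝ, E) x
      (EuclSym.ofAbel q.1 • (extChartAt 𝓘(ℝ, E) x).symm q.2))
      ((orbitDeriv x : (E3 × ℝ) →L[ℝ] E).coprod (ContinuousLinearMap.id ℝ E))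
      (0, extChartAt 𝓘(ℝ, E) x x) := by
  set φ := extChartAt 𝓘(ℝ, E) x
  set G : (E3 × ℝ) × E → E := fun q => φ (EuclSym.ofAbel q.1 • φ.symm q.2) with hG
  have h0 : HasFDerivAt G (fderiv ℝ G (0, φ x)) (0, φ x) :=
    ((contDiffAt_action_inChart (x := x) (q := ((0 : E3 × ℝ), φ x)) (mem_extChartAt_target x)
      (by rw [extChartAt_to_inv, ofAbel_zero_smul]; exact mem_extChartAt_source x)).differentiableAt
      (by simp)).hasFDerivAt
  have h1 : HasFDerivAt (fun p : E3 × ℝ => G (p, φ x))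
      ((fderiv ℝ G (0, φ x)).comp (ContinuousLinearMap.inl ℝ (E3 × ℝ) E)) 0 :=
    HasFDerivAt.comp (g := G) (f := fun p : E3 × ℝ => (p, φ x)) (0 : E3 × ℝ) h0
      (hasFDerivAt_prodMk_left (𝕜 := ℝ) (0 : E3 × ℝ) (φ x))
  have h2 : HasFDerivAt (fun z : E => G (0, z))
      ((fderiv ℝ G (0, φ x)).comp (ContinuousLinearMap.inr ℝ (E3 × ℝ) E)) (φ x) :=
    h0.comp (φ x) (hasFDerivAt_prodMk_right (0 : E3 × ℝ) (φ x))
  have h1' : HasFDerivAt (fun p : E3 × ℝ => G (p, φ x)) (orbitDeriv x : (E3 × ℝ) →L[ℝ] E) 0 := by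
    have := hasFDerivAt_orbitDeriv (E := E) x
    simp only [hG, φ, extChartAt_to_inv]
    exact this
  have h2' : HasFDerivAt (fun z : E => G (0, z)) (ContinuousLinearMap.id ℝ E) (φ x) := by
    refine (hasFDerivAt_id (φ x)).congr_of_eventuallyEq ?_
    filter_upwards [extChartAt_target_mem_nhds (I := 𝓘(ℝ, E)) x] with z hz
    simp only [hG, ofAbel_zero_smul]
    exact φ.right_inv hz
  refine h0.congr_fderiv (ContinuousLinearMap.ext fun q => ?_)
  have e1 := congrArg (fun f : (E3 × ℝ) →L[ℝ] E => f q.1) (h1.unique h1')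
  have e2 := congrArg (fun f : E →L[ℝ] E => f q.2) (h2.unique h2')
  have e3 : q = (q.1, 0) + (0, q.2) := by simp
  simp only [ContinuousLinearMap.comp_apply, ContinuousLinearMap.inl_apply,
    ContinuousLinearMap.inr_apply] at e1 e2
  rw [ContinuousLinearMap.coprod_apply, ← e1, ← e2, ← map_add, ← e3]

variable [FiniteDimensional ℝ E]

/-- **Existence of reduction coordinates.** In the chart at `xe`, a complement of the tangent space
to the `𝒦`-orbit splits into a complement of `ker D J^𝒦`, parametrized by `ν`, and a complement
of the orbit directions in `ker D J^𝒦`, parametrized by `w`. The affine slice so obtained is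
reparametrized by the inverse function theorem so that `J^𝒦 = ν` holds exactly. -/
theorem exists_reductionCoordinates [T2Space M] {Ω : SymplecticForm E M} {J : M → LieDual}
    (hJ : ContMDiff 𝓘(ℝ, E) 𝓘(ℝ, LieDual) ∞ J) (hmom : IsMomentumMap Ω J)
    (hequiv : IsCoadjointEquivariant J) {xe : M} (hx : IsAxisymmetric xe) :
    Nonempty (ReductionCoordinates E J xe) := by
  have : CompleteSpace E := FiniteDimensional.complete ℝ E
  set φ := extChartAt 𝓘(ℝ, E) xe with hφ
  set ν₀ := JK J xe with hν₀
  let j : E → KDual := JK J ∘ φ.symm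
  have hjon : ContDiffOn ℝ ∞ j φ.target := contDiffOn_comp_extChartAt_symm (contMDiff_JK hJ) xe
  have hj (y : E) (hy : y ∈ φ.target) : ContDiffAt ℝ ∞ j y :=
    hjon.contDiffAt ((isOpen_extChartAt_target xe).mem_nhds hy)
  have hj0 : j (φ xe) = ν₀ := congrArg (JK J) (extChartAt_to_inv xe)
  let L : E →L[ℝ] KDual := fderiv ℝ j (φ xe)
  have hL : HasFDerivAt j L (φ xe) :=
    ((hj _ (mem_extChartAt_target xe)).differentiableAt (by simp)).hasFDerivAt
  let A : (E3 × ℝ) →L[ℝ] E := orbitDeriv xe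
  have hsrc : ∀ᶠ p : E3 × ℝ in 𝓝 0, EuclSym.ofAbel p • xe ∈ φ.source := by
    have hc : ContinuousAt (fun p : E3 × ℝ => EuclSym.ofAbel p • xe) 0 :=
      ((contMDiff_ofAbel_smul (E := E)).continuous.comp
        (continuous_id.prodMk continuous_const)).continuousAt
    refine hc.preimage_mem_nhds ?_
    rw [ofAbel_zero_smul]
    exact extChartAt_source_mem_nhds xe
  -- `J^𝒦` is constant along the `𝒦`-orbit
  have hLA (p : E3 × ℝ) : L (A p) = 0 := by
    have h1 := hasFDerivAt_orbitDeriv (E := E) xe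
    have h2 : HasFDerivAt j L (φ (EuclSym.ofAbel 0 • xe)) := by rwa [ofAbel_zero_smul]
    have h3 : HasFDerivAt (fun _ : E3 × ℝ => ν₀) (L.comp A) 0 := by
      refine (h2.comp (0 : E3 × ℝ) h1).congr_of_eventuallyEq ?_
      filter_upwards [hsrc] with p hp
      change ν₀ = JK J (φ.symm (φ (EuclSym.ofAbel p • xe)))
      rw [φ.left_inv hp, hequiv.JK_smul (EuclSym.ofAbel_mem p)]
    exact congrArg (fun f : (E3 × ℝ) →L[ℝ] KDual => f p) (h3.unique (hasFDerivAt_const ν₀ 0))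
  obtain ⟨B, C, hLB, hLC, hbij⟩ := exists_adapted_frame (W := WSpace E) A.toLinearMap L.toLinearMap
    hx.orbitDeriv_injective (hx.fderiv_JK_surjective hJ hmom hL) hLA (by simp)
  let Bc : KDual →L[ℝ] E := B.toContinuousLinearMap
  let Cc : WSpace E →L[ℝ] E := C.toContinuousLinearMap
  let R : (KDual × WSpace E) →L[ℝ] E := Bc.coprod Cc
  let T : ((E3 × ℝ) × KDual × WSpace E) ≃L[ℝ] E :=
    (LinearEquiv.ofBijective (A.coprod R).toLinearMap hbij).toContinuousLinearEquiv
  let q₀ : KDual × WSpace E := (ν₀, 0)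
  -- the affine slice, and the map that expresses its points by `J^𝒦` and `w`
  let σ : KDual × WSpace E → E := fun q => φ xe + R (q - q₀)
  have hσ : ContDiff ℝ ∞ σ := contDiff_const.add (R.contDiff.comp (contDiff_id.sub contDiff_const))
  have hσ0 : σ q₀ = φ xe := by simp [σ]
  have hσ' (q) : HasFDerivAt σ R q := by
    have := (R.hasFDerivAt.comp q ((hasFDerivAt_id q).sub_const q₀)).const_add (φ xe)
    exact this
  have hσt : ∀ᶠ q in 𝓝 q₀, σ q ∈ φ.target := by
    refine hσ.continuous.continuousAt.preimage_mem_nhds ?_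
    rw [hσ0]
    exact extChartAt_target_mem_nhds xe
  let g : KDual × WSpace E → KDual × WSpace E := fun q => (j (σ q), q.2)
  have hg : ∀ᶠ q in 𝓝 q₀, ContDiffAt ℝ ∞ g q := by
    filter_upwards [hσt] with q hq
    exact ((hj _ hq).comp q hσ.contDiffAt).prodMk contDiff_snd.contDiffAt
  have hgid : HasFDerivAt g (ContinuousLinearMap.id ℝ (KDual × WSpace E)) q₀ := by
    have h1 : HasFDerivAt j L (σ q₀) := by rwa [hσ0]
    refine ((h1.comp q₀ (hσ' q₀)).prodMk hasFDerivAt_snd).congr_fderiv ?_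
    refine ContinuousLinearMap.ext fun q => Prod.ext ?_ rfl
    change L (B q.1 + C q.2) = q.1
    rw [map_add]
    exact (congrArg₂ (· + ·) (hLB q.1) (hLC q.2)).trans (add_zero _)
  have hg0 : g q₀ = q₀ := by simp only [g, hσ0, hj0, q₀]
  obtain ⟨h, hh0, hhid, hh⟩ := exists_local_inverse_of_hasFDerivAt_id hg hgid hg0 hσt
  have hh0' : φ.symm (σ (h q₀)) = xe := by rw [hh0, hσ0]; exact extChartAt_to_inv xe
  let F : (E3 × ℝ) × KDual × WSpace E → E :=
    fun x => φ (EuclSym.ofAbel x.1 • φ.symm (σ (h x.2)))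
  have hT : HasFDerivAt F (T : ((E3 × ℝ) × KDual × WSpace E) →L[ℝ] E) (0, q₀) := by
    have h1 : HasFDerivAt (fun x : (E3 × ℝ) × KDual × WSpace E => (x.1, σ (h x.2)))
        ((ContinuousLinearMap.fst ℝ (E3 × ℝ) (KDual × WSpace E)).prod
          (R.comp (ContinuousLinearMap.snd ℝ (E3 × ℝ) (KDual × WSpace E)))) (0, q₀) :=
      hasFDerivAt_fst.prodMk (HasFDerivAt.comp (g := fun q => σ (h q)) ((0 : E3 × ℝ), q₀)
        (HasFDerivAt.comp q₀ (hσ' (h q₀)) hhid) hasFDerivAt_snd)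
    have h2 := hasFDerivAt_action_inChart (E := E) xe
    have e : (((0 : E3 × ℝ), q₀).1, σ (h ((0 : E3 × ℝ), q₀).2)) = ((0 : E3 × ℝ), φ xe) := by
      simp only [hh0, hσ0]
    rw [← hφ, ← e] at h2
    refine (h2.comp ((0 : E3 × ℝ), q₀) h1).congr_fderiv ?_
    exact ContinuousLinearMap.ext fun x => rfl
  have hnear : ∀ᶠ x : (E3 × ℝ) × KDual × WSpace E in 𝓝 (0, q₀),
      ContDiffAt ℝ ∞ h x.2 ∧ g (h x.2) = x.2 ∧ σ (h x.2) ∈ φ.target :=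
    (continuous_snd.continuousAt (x := ((0 : E3 × ℝ), q₀))).eventually hh
  have hmem : ∀ᶠ x : (E3 × ℝ) × KDual × WSpace E in 𝓝 (0, q₀),
      EuclSym.ofAbel x.1 • φ.symm (σ (h x.2)) ∈ φ.source := by
    have h1 : ContinuousAt (fun q => σ (h q)) q₀ :=
      hσ.continuous.continuousAt.comp hhid.continuousAt
    have h2 : ContinuousAt φ.symm (σ (h q₀)) := by
      rw [hh0, hσ0]; exact continuousAt_extChartAt_symm xe
    have h3 : ContinuousAt (fun x : (E3 × ℝ) × KDual × WSpace E => φ.symm (σ (h x.2))) (0, q₀) :=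
      ContinuousAt.comp (g := fun q => φ.symm (σ (h q))) (x := ((0 : E3 × ℝ), q₀))
        (ContinuousAt.comp (x := q₀) h2 h1) continuous_snd.continuousAt
    have h4 : ContinuousAt (fun x : (E3 × ℝ) × KDual × WSpace E =>
        EuclSym.ofAbel x.1 • φ.symm (σ (h x.2))) (0, q₀) :=
      ContinuousAt.comp (g := fun q : (E3 × ℝ) × M => EuclSym.ofAbel q.1 • q.2)
        (contMDiff_ofAbel_smul (E := E)).continuous.continuousAt
        (continuous_fst.continuousAt.prodMk h3)
    refine h4.preimage_mem_nhds ?_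
    simp only [hh0', ofAbel_zero_smul]
    exact extChartAt_source_mem_nhds xe
  have hF : ∀ᶠ x in 𝓝 ((0 : E3 × ℝ), q₀), ContDiffAt ℝ ∞ F x := by
    filter_upwards [hnear, hmem] with x hx1 hx2
    have h1 : ContDiffAt ℝ ∞ (fun x : (E3 × ℝ) × KDual × WSpace E => (x.1, σ (h x.2))) x :=
      contDiff_fst.contDiffAt.prodMk
        (hσ.contDiffAt.comp x (ContDiffAt.comp x hx1.1 contDiff_snd.contDiffAt))
    exact ContDiffAt.comp (g := fun q : (E3 × ℝ) × E => φ (EuclSym.ofAbel q.1 • φ.symm q.2)) x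
      (contDiffAt_action_inChart (x := xe) (q := (x.1, σ (h x.2))) hx1.2.2 hx2) h1
  obtain ⟨Ψ, hΨ0, hΨ, hΨP⟩ := exists_partialDiffeomorph_of_hasFDerivAt hF hT hmem
  have hΨs (x) (hx : x ∈ Ψ.source) :
      φ.symm (Ψ x) = EuclSym.ofAbel x.1 • φ.symm (σ (h x.2)) := by
    rw [hΨ]
    exact φ.left_inv (hΨP x hx)
  have hsource : (Ψ.trans (chartSymmDiffeo xe)).source = Ψ.source := by
    refine Set.inter_eq_left.2 fun x hx => ?_
    change Ψ x ∈ φ.target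
    rw [hΨ]
    exact φ.map_source (hΨP x hx)
  refine ⟨⟨fun ν w => φ.symm (σ (h (ν, w))), hh0', ?_, Ψ.trans (chartSymmDiffeo xe), ?_, ?_⟩⟩
  · filter_upwards [hh] with q hq
    exact congrArg Prod.fst hq.2.1
  · rw [hsource]
    exact hΨ0
  · rw [hsource]
    intro x hx
    exact (hΨs x hx).symm

end Slice

/-! ### Strict minima and their persistence -/

section Lyapunov

open Set

/-- **Second derivative test**: a critical point with positive definite second derivative is a
strict local minimum. -/
theorem eventually_lt_of_fderiv_fderiv_pos {W : Type*} [NormedAddCommGroup W] [NormedSpace ℝ W]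
    [FiniteDimensional ℝ W] {f : W → ℝ} (hf : ContDiffAt ℝ 2 f 0) (h0 : fderiv ℝ f 0 = 0)
    (hpos : ∀ v, v ≠ 0 → 0 < fderiv ℝ (fderiv ℝ f) 0 v v) :
    ∀ᶠ w in 𝓝 (0 : W), w ≠ 0 → f 0 < f w := by
  have hd2 : ContinuousAt (fderiv ℝ (fderiv ℝ f)) 0 :=
    ((hf.fderiv_right (m := 1) (by norm_num)).fderiv_right (m := 0) (by norm_num)).continuousAt
  -- the second derivative stays positive definite near the critical point
  have hnear : ∀ᶠ x in 𝓝 (0 : W), ∀ u ∈ Metric.sphere (0 : W) 1,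
      0 < fderiv ℝ (fderiv ℝ f) x u u := by
    refine (isCompact_sphere (0 : W) 1).eventually_forall_of_forall_eventually fun u hu => ?_
    have hu0 : u ≠ 0 := by
      rintro rfl
      simp at hu
    have hc : ContinuousAt (fun z : W × W => fderiv ℝ (fderiv ℝ f) z.1 z.2 z.2) (0, u) := by
      have h1 : ContinuousAt (fun z : W × W => fderiv ℝ (fderiv ℝ f) z.1) (0, u) :=
        ContinuousAt.comp (g := fderiv ℝ (fderiv ℝ f)) hd2 continuous_fst.continuousAt
      exact (h1.clm_apply continuous_snd.continuousAt).clm_apply continuous_snd.continuousAt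
    exact hc.eventually_const_lt (hpos u hu0)
  have hdiff : ∀ᶠ x in 𝓝 (0 : W), ContDiffAt ℝ 2 f x := hf.eventually (by simp)
  obtain ⟨r, hr, hball⟩ := Metric.eventually_nhds_iff_ball.mp (hnear.and hdiff)
  filter_upwards [Metric.ball_mem_nhds (0 : W) hr] with w hw hw0
  have hmem : ∀ t ∈ Icc (0 : ℝ) 1, t • w ∈ Metric.ball (0 : W) r := by
    intro t ht
    rw [mem_ball_zero_iff] at hw ⊢
    rw [norm_smul, Real.norm_eq_abs, abs_of_nonneg ht.1]
    exact (mul_le_of_le_one_left (norm_nonneg w) ht.2).trans_lt hw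
  have hline (t : ℝ) : HasDerivAt (fun s : ℝ => s • w) w t := by
    simpa using (hasDerivAt_id t).smul_const w
  have hg (t : ℝ) (ht : t ∈ Icc (0 : ℝ) 1) :
      HasDerivAt (fun s : ℝ => f (s • w)) (fderiv ℝ f (t • w) w) t :=
    (((hball _ (hmem t ht)).2.differentiableAt (by simp)).hasFDerivAt).comp_hasDerivAt t (hline t)
  have hg' (t : ℝ) (ht : t ∈ Icc (0 : ℝ) 1) : HasDerivAt (fun s : ℝ => fderiv ℝ f (s • w) w)
      (fderiv ℝ (fderiv ℝ f) (t • w) w w) t := by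
    have h1 := (((hball _ (hmem t ht)).2.fderiv_right (m := 1) (by norm_num)).differentiableAt
      (by simp)).hasFDerivAt.comp_hasDerivAt t (hline t)
    simpa using h1.clm_apply (hasDerivAt_const t w)
  have hpos' (t : ℝ) (ht : t ∈ Icc (0 : ℝ) 1) : 0 < fderiv ℝ (fderiv ℝ f) (t • w) w w := by
    have hn : ‖w‖ ≠ 0 := norm_ne_zero_iff.2 hw0
    have h1 := (hball _ (hmem t ht)).1 (‖w‖⁻¹ • w) (by simp [norm_smul, hn])
    simp only [map_smul, smul_apply, smul_eq_mul] at h1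
    rw [← mul_assoc] at h1
    exact (pos_iff_pos_of_mul_pos h1).1 (by positivity)
  have hmono : StrictMonoOn (fun s : ℝ => fderiv ℝ f (s • w) w) (Icc 0 1) := by
    refine strictMonoOn_of_deriv_pos (convex_Icc 0 1)
      (fun t ht => (hg' t ht).continuousAt.continuousWithinAt) fun t ht => ?_
    rw [(hg' t (interior_subset ht)).deriv]
    exact hpos' t (interior_subset ht)
  have hmono' : StrictMonoOn (fun s : ℝ => f (s • w)) (Icc 0 1) := by
    refine strictMonoOn_of_deriv_pos (convex_Icc 0 1)
      (fun t ht => (hg t ht).continuousAt.continuousWithinAt) fun t ht => ?_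
    rw [(hg t (interior_subset ht)).deriv]
    rw [interior_Icc] at ht
    have h1 := hmono ⟨le_rfl, zero_le_one⟩ (Ioo_subset_Icc_self ht) ht.1
    simpa [h0] using h1
  simpa using hmono' ⟨le_rfl, zero_le_one⟩ ⟨zero_le_one, le_rfl⟩ zero_lt_one

/-- Persistence of a strict minimum under change of parameter: if `h(ν₀, ·)` has a strict local
minimum at `0`, then, at every `ν` near `ν₀`, a point whose `h`-value is also attained near `0` is
itself near `0`, provided it lies in a fixed neighbourhood `B`. -/
theorem exists_nhds_forall_mem_of_eq {N W : Type*} [TopologicalSpace N] [NormedAddCommGroup W]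
    [NormedSpace ℝ W] [FiniteDimensional ℝ W] {h : N × W → ℝ} {ν₀ : N}
    (hc : ∀ᶠ q in 𝓝 (ν₀, (0 : W)), ContinuousAt h q)
    (hmin : ∀ᶠ w in 𝓝 (0 : W), w ≠ 0 → h (ν₀, 0) < h (ν₀, w)) :
    ∃ B ∈ 𝓝 (ν₀, (0 : W)), ∀ U ∈ 𝓝 (ν₀, (0 : W)), ∃ V ∈ 𝓝 (ν₀, (0 : W)),
      ∀ ν w w', (ν, w') ∈ V → (ν, w) ∈ B → h (ν, w) = h (ν, w') → (ν, w) ∈ U := by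
  have hc' : ∀ᶠ w in 𝓝 (0 : W), ContinuousAt h (ν₀, w) :=
    (continuous_const.prodMk continuous_id).continuousAt.eventually hc
  obtain ⟨r, hr, hball⟩ := Metric.nhds_basis_closedBall.eventually_iff.mp (hmin.and hc')
  refine ⟨univ ×ˢ Metric.closedBall 0 r,
    prod_mem_nhds Filter.univ_mem (Metric.closedBall_mem_nhds _ hr), fun U hU => ?_⟩
  obtain ⟨U₁, hU₁, U₂, hU₂, hU₁₂⟩ := mem_nhds_prod_iff.mp hU
  obtain ⟨δ, hδ, hδU⟩ := Metric.mem_nhds_iff.mp hU₂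
  -- the compact shell between the small and the large ball
  have hS : IsCompact (Metric.closedBall (0 : W) r \ Metric.ball 0 δ) :=
    (isCompact_closedBall 0 r).diff Metric.isOpen_ball
  have hlt : ∀ᶠ q : N × W in 𝓝 (ν₀, 0), ∀ w ∈ Metric.closedBall (0 : W) r \ Metric.ball 0 δ,
      h q < h (q.1, w) := by
    refine hS.eventually_forall_of_forall_eventually fun w hw => ?_
    have hw0 : w ≠ 0 := by
      rintro rfl
      exact hw.2 (Metric.mem_ball_self hδ)
    have h1 : ContinuousAt (fun z : (N × W) × W => h z.1) ((ν₀, 0), w) :=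
      ContinuousAt.comp (g := h) hc.self_of_nhds continuous_fst.continuousAt
    have h2 : ContinuousAt (fun z : (N × W) × W => h (z.1.1, z.2)) ((ν₀, 0), w) :=
      ContinuousAt.comp (g := h) (f := fun z : (N × W) × W => (z.1.1, z.2))
        (x := ((ν₀, 0), w)) (hball hw.1).2 (by fun_prop)
    exact h1.eventually_lt h2 ((hball hw.1).1 hw0)
  refine ⟨_, Filter.inter_mem hlt (prod_mem_nhds hU₁ Filter.univ_mem), ?_⟩
  rintro ν w w' ⟨hV1, hV2⟩ hB heq
  refine hU₁₂ (mk_mem_prod hV2.1 (hδU ?_))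
  by_contra hw
  exact (hV1 w ⟨hB.2, hw⟩).ne heq.symm

end Lyapunov

/-! ### Critical points of the reduced Hamiltonian -/

section Stability

open Set

variable {E : Type*} [NormedAddCommGroup E] [NormedSpace ℝ E]
  {M : Type*} [TopologicalSpace M] [ChartedSpace E M] [MulAction EuclSym M]

/-- At an axisymmetric point the generator of `SO(2)_D` vanishes, so the corresponding component of
the momentum map is critical. -/
theorem IsAxisymmetric.infGen_diag_eq_zero {x : M} (hx : IsAxisymmetric x) :
    infGen E ((1, 0, 1) : LieAlg) x = 0 := by
  have h (t : ℝ) : EuclSym.exp (t • ((1, 0, 1) : LieAlg)) • x = x := by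
    rw [← MulAction.mem_stabilizer_iff, hx]
    refine ⟨?_, rfl⟩
    change ∫ s in (0 : ℝ)..1, rotZ (Circle.exp (s * (t • 1))) (t • 0) = 0
    have h0 (z : Circle) : rotZ z (0 : E3) = 0 := by ext i; fin_cases i <;> simp [rotZ]
    simp [h0]
  have h1 : (mfderiv 𝓘(ℝ, ℝ) 𝓘(ℝ, E) (fun t : ℝ => EuclSym.exp (t • ((1, 0, 1) : LieAlg)) • x) 0 :
      ℝ →L[ℝ] E) = 0 := by
    rw [show (fun t : ℝ => EuclSym.exp (t • ((1, 0, 1) : LieAlg)) • x) = fun _ => x from funext h]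
    exact mfderiv_const
  exact congrArg (fun f : ℝ →L[ℝ] E => f 1) h1

variable [FiniteDimensional ℝ E]

/-- At a relative equilibrium the Hamiltonian has the same derivative as a component of `J`. -/
theorem IsRelativeEquilibrium.exists_mfderiv_eq {Ω : SymplecticForm E M} {H : M → ℝ}
    {J : M → LieDual} (hmom : IsMomentumMap Ω J) {x : M}
    (hrel : IsRelativeEquilibrium (Ω.hamVF H) x) :
    ∃ ξ : LieAlg, ∀ v : TangentSpace 𝓘(ℝ, E) x, mfderiv 𝓘(ℝ, E) 𝓘(ℝ, ℝ) H x v =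
      mfderiv 𝓘(ℝ, E) 𝓘(ℝ, ℝ) (fun y => J y ξ) x v := by
  obtain ⟨ξ, hξ⟩ := hrel
  refine ⟨ξ, fun v => ?_⟩
  have h0 : EuclSym.exp ((0 : ℝ) • ξ) • x = x := by rw [zero_smul, EuclSym.exp_zero, one_smul]
  have h1 : infGen E ξ x = Ω.hamVF H x := by
    refine (congrArg (fun f : ℝ →L[ℝ] E => f 1) (hξ 0).mfderiv).trans ?_
    refine (one_smul ℝ (Ω.hamVF H (EuclSym.exp ((0 : ℝ) • ξ) • x) : E)).trans ?_
    exact congrArg (fun y => (Ω.hamVF H y : E)) h0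
  have h2 := hmom ξ x v
  rw [h1] at h2
  exact (Ω.form_hamVF H x v).symm.trans h2

/-- At an axisymmetric relative equilibrium the Hamiltonian has the same derivative as a component
of `J^𝒦`: the rotational part of the velocity can be removed by means of the isotropy group. -/
theorem IsAxisymmetric.exists_mfderiv_sub_eq_zero {Ω : SymplecticForm E M} {H : M → ℝ}
    (hH : ContMDiff 𝓘(ℝ, E) 𝓘(ℝ, ℝ) ∞ H) {J : M → LieDual}
    (hJ : ContMDiff 𝓘(ℝ, E) 𝓘(ℝ, LieDual) ∞ J) (hmom : IsMomentumMap Ω J) {x : M}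
    (hrel : IsRelativeEquilibrium (Ω.hamVF H) x) (hx : IsAxisymmetric x) :
    ∃ p : E3 × ℝ,
      HasMFDerivAt 𝓘(ℝ, E) 𝓘(ℝ, ℝ) (fun y => H y - J y (0, p.1, p.2)) x (0 : E →L[ℝ] ℝ) := by
  obtain ⟨ξ, hξ⟩ := hrel.exists_mfderiv_eq hmom
  have hd (η : LieAlg) := ((contMDiff_momentum_component hJ η).mdifferentiableAt (x := x)
    (by simp)).hasMFDerivAt
  have hdH := (hH.mdifferentiableAt (x := x) (by simp)).hasMFDerivAt
  have hdiag : (mfderiv 𝓘(ℝ, E) 𝓘(ℝ, ℝ) (fun y => J y (1, 0, 1)) x : E →L[ℝ] ℝ) = 0 := by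
    refine ContinuousLinearMap.ext fun v => ?_
    refine (hmom (1, 0, 1) x v).symm.trans ?_
    rw [hx.infGen_diag_eq_zero]
    exact (Ω.form x).toMultilinearMap.map_coord_zero 0 rfl
  have hH' : HasMFDerivAt 𝓘(ℝ, E) 𝓘(ℝ, ℝ) H x
      (mfderiv 𝓘(ℝ, E) 𝓘(ℝ, ℝ) (fun y => J y ξ) x : E →L[ℝ] ℝ) :=
    hdH.congr_mfderiv (ContinuousLinearMap.ext hξ)
  have hdiag' : HasMFDerivAt 𝓘(ℝ, E) 𝓘(ℝ, ℝ) (fun y => J y (1, 0, 1)) x (0 : E →L[ℝ] ℝ) :=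
    (hd _).congr_mfderiv hdiag
  refine ⟨(ξ.2.1, ξ.2.2 - ξ.1), ?_⟩
  have h1 := (hH'.sub (hd ξ)).add (hdiag'.const_smul ξ.1)
  have e : (fun y => H y - J y (0, ξ.2.1, ξ.2.2 - ξ.1)) =
      (H - fun y => J y ξ) + ξ.1 • fun y => J y (1, 0, 1) := by
    ext y
    have h2 : ξ = ((0, ξ.2.1, ξ.2.2 - ξ.1) : LieAlg) + ξ.1 • ((1, 0, 1) : LieAlg) := by
      ext <;> simp
    have h3 : J y ξ = J y (0, ξ.2.1, ξ.2.2 - ξ.1) + ξ.1 * J y (1, 0, 1) := by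
      conv_lhs => rw [h2, map_add, map_smul, smul_eq_mul]
    simp only [Pi.add_apply, Pi.sub_apply, Pi.smul_apply, smul_eq_mul, h3]
    ring
  rw [e]
  refine h1.congr_mfderiv ?_
  refine (congrArg₂ (fun a b : E →L[ℝ] ℝ => a + b) (sub_self _) (smul_zero ξ.1)).trans ?_
  exact add_zero _

end Stability

/-! ### Stability -/

section Stability

open Set

variable {E : Type*} [NormedAddCommGroup E] [NormedSpace ℝ E] {M : Type*} [TopologicalSpace M]
  [ChartedSpace E M] [MulAction EuclSym M] {J : M → LieDual} {xe : M}

namespace ReductionCoordinates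

/-- The parametrization `(a, θ, ν, w) ↦ (0, a, θ) • S(ν, w)` given by reduction coordinates. -/
noncomputable def param (c : ReductionCoordinates E J xe) (p : (E3 × ℝ) × KDual × WSpace E) : M :=
  EuclSym.ofAbel p.1 • c.slice p.2.1 p.2.2

theorem param_base (c : ReductionCoordinates E J xe) : c.param ((0, 0), JK J xe, 0) = xe :=
  (ofAbel_zero_smul _).trans c.slice_base

theorem contMDiffAt_param (c : ReductionCoordinates E J xe) :
    ContMDiffAt 𝓘(ℝ, (E3 × ℝ) × KDual × WSpace E) 𝓘(ℝ, E) ∞ c.param ((0, 0), JK J xe, 0) :=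
  c.localDiffeo.contMDiffAt

/-- The parametrization is open at the base point. -/
theorem image_param_mem_nhds (c : ReductionCoordinates E J xe)
    {s : Set ((E3 × ℝ) × KDual × WSpace E)} (hs : s ∈ 𝓝 ((0, 0), JK J xe, 0)) :
    c.param '' s ∈ 𝓝 xe := by
  obtain ⟨Ψ, hb, hΨ⟩ := c.localDiffeo
  have h1 : Filter.map Ψ (𝓝 ((0, 0), JK J xe, 0)) = 𝓝 (Ψ ((0, 0), JK J xe, 0)) :=
    Ψ.toOpenPartialHomeomorph.map_nhds_eq hb
  have h2 : Ψ ((0, 0), JK J xe, 0) = xe := (hΨ hb).symm.trans c.param_base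
  have h3 : Ψ '' (s ∩ Ψ.source) ∈ 𝓝 xe := by
    rw [← h2, ← h1]
    exact Filter.image_mem_map (Filter.inter_mem hs (Ψ.open_source.mem_nhds hb))
  refine Filter.mem_of_superset h3 ?_
  rintro _ ⟨p, hp, rfl⟩
  exact ⟨p, hp.1, hΨ hp.2⟩

theorem contMDiffAt_slice (c : ReductionCoordinates E J xe) :
    ContMDiffAt 𝓘(ℝ, KDual × WSpace E) 𝓘(ℝ, E) ∞
      (fun q : KDual × WSpace E => c.slice q.1 q.2) (JK J xe, 0) := by
  have h1 : ContMDiff 𝓘(ℝ, KDual × WSpace E) 𝓘(ℝ, (E3 × ℝ) × KDual × WSpace E) ∞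
      (fun q : KDual × WSpace E => (((0, 0), q) : (E3 × ℝ) × KDual × WSpace E)) :=
    (contDiff_const.prodMk contDiff_id).contMDiff
  have h2 := ContMDiffAt.comp (g := c.param) (JK J xe, (0 : WSpace E)) c.contMDiffAt_param
    h1.contMDiffAt
  exact h2.congr_of_eventuallyEq (Filter.Eventually.of_forall fun q => (ofAbel_zero_smul _).symm)

theorem contDiffAt_redHam (c : ReductionCoordinates E J xe) {H : M → ℝ}
    (hH : ContMDiff 𝓘(ℝ, E) 𝓘(ℝ, ℝ) ∞ H) :
    ContDiffAt ℝ ∞ (fun q : KDual × WSpace E => c.redHam H q.1 q.2) (JK J xe, 0) :=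
  (ContMDiffAt.comp (g := H) (f := fun q : KDual × WSpace E => c.slice q.1 q.2)
    (JK J xe, (0 : WSpace E)) hH.contMDiffAt c.contMDiffAt_slice).contDiffAt

theorem contDiffAt_redHam_right (c : ReductionCoordinates E J xe) {H : M → ℝ}
    (hH : ContMDiff 𝓘(ℝ, E) 𝓘(ℝ, ℝ) ∞ H) :
    ContDiffAt ℝ ∞ (fun w : WSpace E => c.redHam H (JK J xe) w) 0 :=
  ContDiffAt.comp (g := fun q : KDual × WSpace E => c.redHam H q.1 q.2)
    (f := fun w : WSpace E => (JK J xe, w)) (0 : WSpace E) (c.contDiffAt_redHam hH)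
    (contDiffAt_const.prodMk contDiffAt_id)

variable [FiniteDimensional ℝ E]

/-- The origin is a critical point of the reduced Hamiltonian at momentum `ν_e`: on the slice of
fixed momentum, `H` differs by a constant from a function that is critical at `x_e`. -/
theorem fderiv_redHam_eq_zero (c : ReductionCoordinates E J xe) {Ω : SymplecticForm E M}
    {H : M → ℝ} (hH : ContMDiff 𝓘(ℝ, E) 𝓘(ℝ, ℝ) ∞ H) (hJ : ContMDiff 𝓘(ℝ, E) 𝓘(ℝ, LieDual) ∞ J)
    (hmom : IsMomentumMap Ω J) (hrel : IsRelativeEquilibrium (Ω.hamVF H) xe)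
    (hx : IsAxisymmetric xe) :
    fderiv ℝ (fun w : WSpace E => c.redHam H (JK J xe) w) 0 = 0 := by
  obtain ⟨p, hp⟩ := hx.exists_mfderiv_sub_eq_zero hH hJ hmom hrel
  have hs : HasMFDerivAt 𝓘(ℝ, WSpace E) 𝓘(ℝ, E) (fun w => c.slice (JK J xe) w) 0
      (mfderiv 𝓘(ℝ, WSpace E) 𝓘(ℝ, E) (fun w => c.slice (JK J xe) w) 0 : WSpace E →L[ℝ] E) := by
    refine MDifferentiableAt.hasMFDerivAt ?_
    exact ((ContMDiffAt.comp (g := fun q : KDual × WSpace E => c.slice q.1 q.2) (0 : WSpace E)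
      c.contMDiffAt_slice (contDiff_const.prodMk contDiff_id).contMDiff.contMDiffAt)
      ).mdifferentiableAt (by simp)
  rw [← c.slice_base] at hp
  have h1 := (HasMFDerivAt.comp (0 : WSpace E) hp hs).hasFDerivAt
  have h2 : HasFDerivAt (fun w : WSpace E => H (c.slice (JK J xe) w) -
      J (c.slice (JK J xe) w) (0, p.1, p.2)) (0 : WSpace E →L[ℝ] ℝ) 0 :=
    h1.congr_fderiv (ContinuousLinearMap.zero_comp _)
  have h3 : ∀ᶠ w in 𝓝 (0 : WSpace E), JK J (c.slice (JK J xe) w) = JK J xe :=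
    (continuous_const.prodMk continuous_id).continuousAt.eventually c.momentum
  have h4 := h2.add_const (J xe (0, p.1, p.2))
  refine (h4.congr_of_eventuallyEq ?_).fderiv
  filter_upwards [h3] with w hw
  rw [redHam, momentum_component_eq J (c.slice (JK J xe) w), momentum_component_eq J xe, hw]
  ring

/-- If the Hessian is definite, points of the slice having momentum and energy in common with a
point near `x_e` are near `x_e`, provided they lie in a fixed neighbourhood. -/
theorem HessianDefinite.exists_nhds_forall_mem {c : ReductionCoordinates E J xe}
    {Ω : SymplecticForm E M} {H : M → ℝ} (hc : c.HessianDefinite H)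
    (hH : ContMDiff 𝓘(ℝ, E) 𝓘(ℝ, ℝ) ∞ H) (hJ : ContMDiff 𝓘(ℝ, E) 𝓘(ℝ, LieDual) ∞ J)
    (hmom : IsMomentumMap Ω J) (hrel : IsRelativeEquilibrium (Ω.hamVF H) xe)
    (hx : IsAxisymmetric xe) :
    ∃ B ∈ 𝓝 (JK J xe, (0 : WSpace E)), ∀ U ∈ 𝓝 (JK J xe, (0 : WSpace E)),
      ∃ V ∈ 𝓝 (JK J xe, (0 : WSpace E)), ∀ ν w w', (ν, w') ∈ V → (ν, w) ∈ B →
        c.redHam H ν w = c.redHam H ν w' → (ν, w) ∈ U := by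
  have hd : ContDiffAt ℝ 2 (fun w : WSpace E => c.redHam H (JK J xe) w) 0 :=
    contDiffAt_infty.1 (c.contDiffAt_redHam_right hH) 2
  have h0 := c.fderiv_redHam_eq_zero hH hJ hmom hrel hx
  have hcont : ∀ᶠ q in 𝓝 (JK J xe, (0 : WSpace E)),
      ContinuousAt (fun q : KDual × WSpace E => c.redHam H q.1 q.2) q := by
    have h1 : ContDiffAt ℝ 1 (fun q : KDual × WSpace E => c.redHam H q.1 q.2) (JK J xe, 0) :=
      (c.contDiffAt_redHam hH).of_le (by simp)
    exact (h1.eventually (by simp)).mono fun q hq => hq.continuousAt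
  have hess (v : WSpace E) : c.hessian H v v =
      fderiv ℝ (fderiv ℝ fun w => c.redHam H (JK J xe) w) 0 v v := by
    simp [hessian, iteratedFDeriv_two_apply]
  rcases hc with hpos | hneg
  · exact exists_nhds_forall_mem_of_eq hcont
      (eventually_lt_of_fderiv_fderiv_pos hd h0 fun v hv => hess v ▸ hpos v hv)
  -- in the negative definite case `-H` plays the role of `H`
  · have hmin : ∀ᶠ w in 𝓝 (0 : WSpace E), w ≠ 0 →
        -c.redHam H (JK J xe) 0 < -c.redHam H (JK J xe) w := by
      have e : fderiv ℝ (fun w => -c.redHam H (JK J xe) w) =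
          fun w => -fderiv ℝ (fun w => c.redHam H (JK J xe) w) w := funext fun w => fderiv_fun_neg
      refine eventually_lt_of_fderiv_fderiv_pos hd.neg ?_ fun v hv => ?_
      · rw [e]
        exact neg_eq_zero.2 h0
      · rw [e, fderiv_fun_neg, neg_apply, neg_apply, ← hess]
        exact neg_pos.2 (hneg v hv)
    obtain ⟨B, hB, h⟩ := exists_nhds_forall_mem_of_eq
      (h := fun q : KDual × WSpace E => -c.redHam H q.1 q.2)
      (hcont.mono fun q hq => hq.neg) hmin
    refine ⟨B, hB, fun U hU => ?_⟩
    obtain ⟨V, hV, hVU⟩ := h U hU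
    exact ⟨V, hV, fun ν w w' h1 h2 h3 => hVU ν w w' h1 h2 (congrArg Neg.neg h3)⟩

end ReductionCoordinates

theorem IsStableModulo.mono {f : (x : M) → TangentSpace 𝓘(ℝ, E) x} {A B : Set EuclSym}
    (h : IsStableModulo f A xe) (hAB : A ⊆ B) : IsStableModulo f B xe := by
  intro N hN
  obtain ⟨V, hV, hVγ⟩ := h N hN
  refine ⟨V, hV, fun x hx => ?_⟩
  obtain ⟨γ, h0, hγ, hγN⟩ := hVγ x hx
  exact ⟨γ, h0, hγ, fun t => smul_subset_smul_right hAB (hγN t)⟩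

variable [FiniteDimensional ℝ E] [IsManifold 𝓘(ℝ, E) ∞ M] [T2Space M]
  [ContMDiffSMul EuclSym.model 𝓘(ℝ, E) ∞ EuclSym M]

/-- A definite Hessian confines the level sets of `(J^𝒦, H)` near the orbit `𝒦 x_e`; since the flow
commutes with `𝒦`, solutions through such a level set have a uniform time of existence, so that they
are global and remain near the orbit. -/
theorem ReductionCoordinates.HessianDefinite.isStableModulo {c : ReductionCoordinates E J xe}
    {Ω : SymplecticForm E M} {H : M → ℝ} (hc : c.HessianDefinite H) (hΩ : IsSymplecticAction Ω)
    (hH : ContMDiff 𝓘(ℝ, E) 𝓘(ℝ, ℝ) ∞ H) (hHinv : ∀ (g : EuclSym) (x : M), H (g • x) = H x)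
    (hJ : ContMDiff 𝓘(ℝ, E) 𝓘(ℝ, LieDual) ∞ J)
    (hmom : IsMomentumMap Ω J) (hequiv : IsCoadjointEquivariant J)
    (hrel : IsRelativeEquilibrium (Ω.hamVF H) xe) (hx : IsAxisymmetric xe) :
    IsStableModulo (Ω.hamVF H) (EuclSym.abel : Set EuclSym) xe := by
  intro N hN
  have : CompleteSpace E := FiniteDimensional.complete ℝ E
  have : IsManifold 𝓘(ℝ, E) 1 M := .of_le (n := ∞) (by simp)
  have hv := Ω.contMDiff_hamVF hH
  obtain ⟨B, hB, hBU⟩ := hc.exists_nhds_forall_mem hH hJ hmom hrel hx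
  have hdrop {s : Set (KDual × WSpace E)} (hs : s ∈ 𝓝 (JK J xe, (0 : WSpace E))) :
      Prod.snd ⁻¹' s ∈ 𝓝 (((0, 0), JK J xe, 0) : (E3 × ℝ) × KDual × WSpace E) :=
    continuous_snd.continuousAt.preimage_mem_nhds hs
  -- solutions starting in `U` remain, for times less than `ε`, where reduction coordinates are
  -- available and the Lyapunov estimate applies
  have hW := Filter.inter_mem hN (c.image_param_mem_nhds (hdrop (Filter.inter_mem hB c.momentum)))
  obtain ⟨U, hU, ε, hε, hflow⟩ := exists_uniform_isMIntegralCurveOn hv.contMDiffAt hW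
  have hUN : U ⊆ N := by
    intro x hxU
    obtain ⟨γ, h0, -, hγ⟩ := hflow x hxU
    exact h0 ▸ (hγ 0 ⟨neg_lt_zero.2 hε, hε⟩).1
  have hU' : {q : KDual × WSpace E | c.slice q.1 q.2 ∈ U} ∈ 𝓝 (JK J xe, (0 : WSpace E)) :=
    c.contMDiffAt_slice.continuousAt.preimage_mem_nhds (by simpa [c.slice_base] using hU)
  obtain ⟨V, hV, hVU⟩ := hBU _ hU'
  refine ⟨_, c.image_param_mem_nhds
    (hdrop (Filter.inter_mem hV (Filter.inter_mem c.momentum hU'))), ?_⟩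
  rintro _ ⟨⟨p, ν, w'⟩, ⟨hV', hmom', hU''⟩, rfl⟩
  have hJp (p : E3 × ℝ) (q : KDual × WSpace E) :
      JK J (c.param (p, q)) = JK J (c.slice q.1 q.2) := hequiv.JK_smul (ofAbel_mem p) _
  -- the part of the level set of the conserved quantities that meets `𝒦 • U`
  let A : Set M := {y | (∃ k ∈ EuclSym.abel, ∃ u ∈ U, y = k • u) ∧ JK J y = ν ∧
    H y = c.redHam H ν w'}
  have hA : ∀ y ∈ A, ∃ γ : ℝ → M, γ 0 = y ∧ IsMIntegralCurveOn γ (Ω.hamVF H) (Ioo (-ε) ε) ∧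
      ∀ t ∈ Ioo (-ε) ε, γ t ∈ A := by
    rintro _ ⟨⟨k, hk, u, hu, rfl⟩, hJy, hHy⟩
    obtain ⟨γ, h0, hγ, hγW⟩ := hflow u hu
    refine ⟨fun t => k • γ t, by simp [h0], hγ.smul_hamVF hΩ hH hHinv k, fun t ht => ?_⟩
    -- `γ t` has reduction coordinates `(p', ν', w)`, and `(ν', w)` is near the base point by
    -- conservation of `J^𝒦` and `H`; the position `p'` on the orbit is absorbed by `𝒦`
    obtain ⟨-, ⟨p', ν', w⟩, ⟨hwB, hw⟩, hpt⟩ := hγW t ht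
    have hHt : H (γ t) = H u := h0 ▸ hγ.eq_of_mfderiv_eq_zero (hH.mdifferentiable (by simp))
      (Ω.mfderiv_hamVF_self H) ht
    have hJc (ξ : LieAlg) : J (γ t) ξ = J u ξ := h0 ▸ hγ.eq_of_mfderiv_eq_zero
      ((contMDiff_momentum_component hJ ξ).mdifferentiable (by simp))
      (hmom.mfderiv_hamVF_eq_zero hH hHinv ξ) ht
    have hJt : JK J (γ t) = ν := by
      rw [← hJy, hequiv.JK_smul hk]
      simp only [JK, hJc]
    have hνν : ν' = ν := by
      rw [← hJt, ← hpt, hJp]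
      exact hw.symm
    subst hνν
    have hred : c.redHam H ν' w = c.redHam H ν' w' := by
      rw [← hHy, hHinv, ← hHt, ← hpt, ReductionCoordinates.param, hHinv]
      rfl
    refine ⟨⟨k * EuclSym.ofAbel p', mul_mem hk (ofAbel_mem p'), c.slice ν' w,
      hVU ν' w w' hV' hwB hred, ?_⟩, ?_, ?_⟩
    · rw [mul_smul]
      exact congrArg (k • ·) hpt.symm
    · rw [hequiv.JK_smul hk, hJt]
    · rw [hHinv, hHt, ← hHy, hHinv]
  have hxA : c.param (p, ν, w') ∈ A :=
    ⟨⟨_, ofAbel_mem p, _, hU'', rfl⟩, (hJp _ _).trans hmom', hHinv _ _⟩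
  obtain ⟨γ, h0, hγ, hγA⟩ := exists_isMIntegralCurve_mem_of_uniform hv hε hA hxA
  refine ⟨γ, h0, hγ, fun t => ?_⟩
  obtain ⟨⟨k, hk, u, hu, he⟩, -⟩ := hγA t
  exact he ▸ smul_mem_smul hk (hUN hu)

end Stability

theorem mainTheorem4
    {E : Type*} [NormedAddCommGroup E] [NormedSpace ℝ E] [FiniteDimensional ℝ E]
    {M : Type*} [TopologicalSpace M] [ChartedSpace E M] [IsManifold 𝓘(ℝ, E) ∞ M]
    [T2Space M] [SecondCountableTopology M] [ConnectedSpace M]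
    (Ω : SymplecticForm E M)
    [MulAction EuclSym M] [ContMDiffSMul EuclSym.model 𝓘(ℝ, E) ∞ EuclSym M]
    [ProperSMul EuclSym M] [FaithfulSMul EuclSym M]
    (hΩ : IsSymplecticAction Ω)
    (H : M → ℝ) (hH : ContMDiff 𝓘(ℝ, E) 𝓘(ℝ, ℝ) ∞ H)
    (hHinv : ∀ (g : EuclSym) (x : M), H (g • x) = H x)
    (J : M → EuclSym.LieDual) (hJ : ContMDiff 𝓘(ℝ, E) 𝓘(ℝ, EuclSym.LieDual) ∞ J)
    (hmom : IsMomentumMap Ω J) (hequiv : IsCoadjointEquivariant J)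
    (xe : M) (hrel : IsRelativeEquilibrium (Ω.hamVF H) xe) (haxi : IsAxisymmetric xe) :
    Nonempty (ReductionCoordinates E J xe) ∧
      ∀ c : ReductionCoordinates E J xe, c.HessianDefinite H →
        IsStableModulo (Ω.hamVF H) (EuclSym.abel : Set EuclSym) xe ∧
          IsStableModulo (Ω.hamVF H) (Set.univ : Set EuclSym) xe := by
  refine ⟨exists_reductionCoordinates hJ hmom hequiv haxi, fun c hc => ?_⟩
  have h := hc.isStableModulo hΩ hH hHinv hJ hmom hequiv hrel haxi
  exact ⟨h, h.mono (Set.subset_univ _)⟩
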